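/- **Definitions.** Let $M$ be a smooth manifold and $T:M\to M$ a smooth ($\mathcal C^\infty$) diffeomorphism. A compact set $K\subset M$ with $T(K)=K$ is a *hyperbolic basic set* for $T$ if * $K$ is hyperbolic: there are a smooth Riemannian metric on a neighbourhood of $K$, a decomposition $T_xM=E^u_x\oplus E^s_x$ for each $x\in K$ with $D_xT(E^i_x)=E^i_{Tx}$ ($i\in\{u,s\}$), and constants $\lambda>1$, $c>0$ such that $\|D_xT^n|_{E^s_x}\|\le c\lambda^{-n}$ and $\|D_xT^{-n}|_{E^u_x}\|\le c\lambda^{-n}$ for all $n\in\mathbb N$ and $x\in K$; * $K$ is isolated: $K=\bigcap_{n\in\mathbb Z}T^n(V)$ for some neighbourhood $V$ of $K$; * $T|_K$ is topologically transitive. For $g:M\to\mathbb C$ put $g^{(n)}(x)=\prod_{k=0}^{n-1}g(T^kx)$. If $\{x\in K: T^nx=x\}$ is finite for every $n\ge1$, define the formal power series $$\zeta_{T,g}(z)=\exp\Big(\sum_{n\ge1}\frac1n\sum_{x\in K,\,T^nx=x}g^{(n)}(x)\,z^n\Big),\qquad d_{T,g}(z)=\exp\Big(-\sum_{n\ge1}\frac1n\sum_{x\in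 K,\,T^nx=x}\frac{g^{(n)}(x)}{|\det(I-D_xT^n)|}\,z^n\Big).$$ **Proposition.** There are a smooth diffeomorphism $T$ of the sphere $S^4$ and a hyperbolic basic set $K$ for $T$, with $\{x\in K:T^nx=x\}$ finite for all $n\ge1$, such that the following holds. Let $h$ be any holomorphic function on a neighbourhood of $0$ with expansion $h(z)=\sum_{k\ge0}\alpha_kz^k$ at $0$, such that $\alpha_k\ne-1$ for all $k\in\mathbb N$ and such that the radius of convergence $\rho\in(0,\infty]$ of this power series satisfies $\rho>1$. Then there is a function $g:S^4\to\mathbb C$ such that: 1. $\zeta_{T,g}(z)^{-1}=1-2z-z(1-z)h(z)$, as formal power series and as functions near $0$; in particular, the power series $\zeta_{T,g}^{-1}$ converges for $|z|<\rho$; 2. the power series $d_{T,g}$ converges for $|z|<16\rho$, and on this disc $$d_{T,g}(z)=\prod_{k=0}^{\infty}\Big(\zeta_{T,g}\big(z/4^{k+2}\big)^{-1}\Big)^{\frac{(k+1)(k+2)(k+3)}6},$$ where the infinite product converges locally uniformly and $\zeta_{T,g}(w)^{-1}$ denotes the sum at $w$ of the power series $\zeta_{T,g}^{-1}$ (for $|w|<\rho$);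 3. $g$ is $\mathcal C^r$ for every integer $r\ge0$ with $r<\frac{\ln\rho}{\ln4}$ (for every $r$ if $\rho=\infty$); 4. if $\alpha_k\in\,]-1,+\infty[$ for all $k$, then $g$ is real and strictly positive on $K$. -/

import Mathlib

open scoped Manifold ContDiff Topology ENNReal Bundle

/-- A smooth Riemannian metric on the open subset `W` of the manifold `M`: an inner product on the
tangent spaces at the points of `W`, varying smoothly on `W` as a section of the bundle of
bilinear forms. (The values of `inner` outside `W` are irrelevant.) -/
structure LocalRiemannianMetric (d : ℕ) (M : Type*) [TopologicalSpace M]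
    [ChartedSpace (EuclideanSpace ℝ (Fin d)) M] [IsManifold (𝓡 d) ∞ M] (W : Set M) where
  inner (x : M) : TangentSpace (𝓡 d) x →L[ℝ] TangentSpace (𝓡 d) x →L[ℝ] ℝ
  isOpen_domain : IsOpen W
  symm (x : M) (hx : x ∈ W) (v w : TangentSpace (𝓡 d) x) : inner x v w = inner x w v
  pos (x : M) (hx : x ∈ W) (v : TangentSpace (𝓡 d) x) (hv : v ≠ 0) : 0 < inner x v v
  contMDiffOn : ContMDiffOn (𝓡 d)
    ((𝓡 d).prod 𝓘(ℝ, EuclideanSpace ℝ (Fin d) →L[ℝ] EuclideanSpace ℝ (Fin d) →L[ℝ] ℝ)) ∞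
    (fun x ↦ Bundle.TotalSpace.mk'
      (EuclideanSpace ℝ (Fin d) →L[ℝ] EuclideanSpace ℝ (Fin d) →L[ℝ] ℝ)
      (E := fun x ↦ TangentSpace (𝓡 d) x →L[ℝ] TangentSpace (𝓡 d) x →L[ℝ] ℝ) x (inner x)) W

/-- The norm of a tangent vector for a Riemannian metric. -/
noncomputable def LocalRiemannianMetric.tnorm {d : ℕ} {M : Type*} [TopologicalSpace M]
    [ChartedSpace (EuclideanSpace ℝ (Fin d)) M] [IsManifold (𝓡 d) ∞ M] {W : Set M}
    (γ : LocalRiemannianMetric d M W) (x : M) (v : TangentSpace (𝓡 d) x) : ℝ :=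
  Real.sqrt (γ.inner x v v)

/-- The `T`-invariant set `K` is hyperbolic: there are a Riemannian metric on a neighbourhood of `K`
and an invariant splitting `T_x M = E^u_x ⊕ E^s_x` over `K`, such that `D T^n` contracts `E^s` and
`D T^{-n}` contracts `E^u`, with uniform exponential rates. -/
def IsHyperbolicSet {d : ℕ} {M : Type*} [TopologicalSpace M]
    [ChartedSpace (EuclideanSpace ℝ (Fin d)) M] [IsManifold (𝓡 d) ∞ M]
    (T : M ≃ₘ⟮𝓡 d, 𝓡 d⟯ M) (K : Set M) : Prop :=
  ∃ (W : Set M) (γ : LocalRiemannianMetric d M W)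
    (Eu Es : ∀ x : M, Submodule ℝ (TangentSpace (𝓡 d) x)) (lam c : ℝ),
    K ⊆ W ∧ 1 < lam ∧ 0 < c ∧
    ∀ x ∈ K,
      IsCompl (Eu x) (Es x) ∧
      (Eu x).map (mfderiv (𝓡 d) (𝓡 d) T x).toLinearMap = Eu (T x) ∧
      (Es x).map (mfderiv (𝓡 d) (𝓡 d) T x).toLinearMap = Es (T x) ∧
      (∀ n : ℕ, ∀ v ∈ Es x,
        γ.tnorm (T^[n] x) (mfderiv (𝓡 d) (𝓡 d) (T^[n]) x v) ≤ c * (lam ^ n)⁻¹ * γ.tnorm x v) ∧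
      (∀ n : ℕ, ∀ v ∈ Eu x,
        γ.tnorm (T.symm^[n] x) (mfderiv (𝓡 d) (𝓡 d) (T.symm^[n]) x v) ≤
          c * (lam ^ n)⁻¹ * γ.tnorm x v)

/-- A hyperbolic basic set of a smooth diffeomorphism: a compact invariant set that is hyperbolic,
isolated, and on which the dynamics is topologically transitive. -/
structure IsHyperbolicBasicSet {d : ℕ} {M : Type*} [TopologicalSpace M]
    [ChartedSpace (EuclideanSpace ℝ (Fin d)) M] [IsManifold (𝓡 d) ∞ M]
    (T : M ≃ₘ⟮𝓡 d, 𝓡 d⟯ M) (K : Set M) : Prop where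
  isCompact : IsCompact K
  invariant : T '' K = K
  hyperbolic : IsHyperbolicSet T K
  isolated : ∃ V ∈ 𝓝ˢ K, K = ⋂ n : ℤ, ((T.toEquiv : Equiv.Perm M) ^ n) '' V
  transitive : ∀ A B : Set M, IsOpen A → IsOpen B → (A ∩ K).Nonempty → (B ∩ K).Nonempty →
    ∃ n : ℕ, (T^[n] '' (A ∩ K) ∩ B).Nonempty

/-- The exponential of a formal power series `S` without constant term. -/
noncomputable def formalExp (S : PowerSeries ℂ) : PowerSeries ℂ :=
  (PowerSeries.exp ℂ).subst S

/-- The Birkhoff product `g^{(n)}(x) = ∏_{k < n} g (T^k x)`. -/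
def birkhoffProduct {M : Type*} (T : M → M) (g : M → ℂ) (n : ℕ) (x : M) : ℂ :=
  ∏ k ∈ Finset.range n, g (T^[k] x)

/-- The fixed points of `T^n` in `K`. -/
def periodicPointsIn {M : Type*} (T : M → M) (K : Set M) (n : ℕ) : Set M :=
  {x ∈ K | T^[n] x = x}

/-- The weighted dynamical zeta function of `(T, g)` on `K`, as a formal power series:
`ζ(z) = exp (∑_{n ≥ 1} (1/n) (∑_{x ∈ K, T^n x = x} g^{(n)}(x)) z^n)`. -/
noncomputable def dynamicalZeta {M : Type*} (T : M → M) (K : Set M) (g : M → ℂ) : PowerSeries ℂ :=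
  formalExp (PowerSeries.mk fun n ↦
    if n = 0 then 0 else
      (1 / (n : ℂ)) * ∑ᶠ x ∈ periodicPointsIn T K n, birkhoffProduct T g n x)

/-- The determinant of `I - D_x T^n` at a fixed point `x` of `T^n`. Both `T_x M` and
`T_{T^n x} M` are by definition copies of the model space, through the preferred charts at `x` and
at `T^n x`; when `T^n x = x` these two charts are the same, so that `D_x T^n` is an endomorphism
of `T_x M` and this is its intrinsic determinant. It is only used at such points. -/
noncomputable def detIdSubDeriv {d : ℕ} {M : Type*} [TopologicalSpace M]
    [ChartedSpace (EuclideanSpace ℝ (Fin d)) M] (T : M → M) (n : ℕ) (x : M) : ℝ :=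
  let D : EuclideanSpace ℝ (Fin d) →L[ℝ] EuclideanSpace ℝ (Fin d) :=
    mfderiv (𝓡 d) (𝓡 d) (T^[n]) x
  LinearMap.det (LinearMap.id - D.toLinearMap)

/-- The flat trace `∑_{x ∈ K, T^n x = x} g^{(n)}(x) / |det (I - D_x T^n)|`. -/
noncomputable def flatTrace {d : ℕ} {M : Type*} [TopologicalSpace M]
    [ChartedSpace (EuclideanSpace ℝ (Fin d)) M] (T : M → M) (K : Set M) (g : M → ℂ) (n : ℕ) : ℂ :=
  ∑ᶠ x ∈ periodicPointsIn T K n,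
    birkhoffProduct T g n x / ((|detIdSubDeriv (d := d) T n x| : ℝ) : ℂ)

/-- The dynamical determinant of `(T, g)` on `K`, as a formal power series:
`d(z) = exp (- ∑_{n ≥ 1} (1/n) (flat trace at step n) z^n)`. -/
noncomputable def dynamicalDeterminant {d : ℕ} {M : Type*} [TopologicalSpace M]
    [ChartedSpace (EuclideanSpace ℝ (Fin d)) M] (T : M → M) (K : Set M) (g : M → ℂ) :
    PowerSeries ℂ :=
  formalExp (PowerSeries.mk fun n ↦
    if n = 0 then 0 else -((1 / (n : ℂ)) * flatTrace (d := d) T K g n))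

/-- The terms at `z` of a formal power series. -/
noncomputable def seriesTerm (f : PowerSeries ℂ) (z : ℂ) (n : ℕ) : ℂ :=
  PowerSeries.coeff n f * z ^ n

/-- The sum at `z` of a formal power series (used where the series converges). -/
noncomputable def seriesSum (f : PowerSeries ℂ) (z : ℂ) : ℂ :=
  ∑' n, seriesTerm f z n

/-- The unit sphere `S^4` of `ℝ^5`. -/
abbrev S4 : Type := Metric.sphere (0 : EuclideanSpace ℝ (Fin 5)) 1

/-! The set `K` is a horseshoe on which the map is affine in one fixed chart, with linear part
diag(4, 4, 1/4, 1/4). It is coded by the full shift on bi-infinite sequences of `true` and `false`,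
so the fixed points of the `n`-th iterate in `K` correspond to the words of length `n`.

Weights. The weight is 1 at a sequence with `s 0 = false`, and `1 + α k` at one that starts with
`true`, then exactly `k` times `false`, then `true`. Put W(z) = ∑ (1 + α k) z^(k+1). A renewal
argument on cyclic words gives the generating function z W'(z) / (1 - W(z)) for the weighted words
containing a `true`, and the all-`false` word adds z / (1 - z). Hence ζ⁻¹ = (1 - z)(1 - W) = 1 - 2z
- z(1 - z)h (`expTrace_sum_cyclicWeight`).

Determinant. At a fixed point of the `n`-th iterate, |det(I - D)| = (4^n - 1)²(1 - 4^(-n))², and its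
inverse is ∑ C(k+3, 3) 4^(-n(k+2)) (`hasSum_inv_det`). So the flat traces are weighted sums of
rescaled traces, and the determinant is the corresponding product of rescaled ζ⁻¹
(`hasProdLocallyUniformlyOn_expTrace`).

Regularity. The first coordinate u of a coded point is a base 4 expansion with digits 0 and 3. The
sequences of weight `1 + α k` satisfy 4^(k+1)(u - 3/4) ∈ [3/4, 1], so the weight is 1 plus a sum of
`α k` times bumps of width about 4^(-k). Its derivatives up to order r converge when ∑ |α k| 4^(rk)
does, that is when 4^r < ρ (`contDiff_bumpSeries`).

Geometry. Positively homogeneous maps of ℝ⁵ act on S⁴, and the central projection y ↦ (y, 1)/‖(y,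
1)‖ serves as the chart. A diagonal map followed by two localized rotations realizes both affine
branches (`horseshoeConic_liftOne`). -/

/-! ### Formal exponentials of trace sequences. -/

open PowerSeries in
theorem constantCoeff_formalExp {S : PowerSeries ℂ} (hS : constantCoeff S = 0) :
    constantCoeff (formalExp S) = 1 := by
  have h : MvPowerSeries.constantCoeff S = 0 := hS
  change MvPowerSeries.constantCoeff ((exp ℂ).subst S) = 1
  rw [constantCoeff_subst (HasSubst.of_constantCoeff_zero' hS), finsum_eq_single _ 0]
  · simp
  · intro n hn
    simp [h, hn]

open PowerSeries in
theorem derivative_formalExp {S : PowerSeries ℂ} (hS : constantCoeff S = 0) :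
    d⁄dX ℂ (formalExp S) = formalExp S * d⁄dX ℂ S := by
  rw [formalExp, derivative_subst (HasSubst.of_constantCoeff_zero' hS), derivative_exp]

open PowerSeries in
/-- A power series with constant term `1` is determined by its logarithmic derivative. -/
theorem eq_of_derivative_eq_mul {F G R : PowerSeries ℂ} (hF : constantCoeff F = 1)
    (hG : constantCoeff G = 1) (hF' : d⁄dX ℂ F = F * R) (hG' : d⁄dX ℂ G = G * R) : F = G := by
  have hG0 : constantCoeff G ≠ 0 := by simp [hG]
  have h1 : F * G⁻¹ = 1 := by
    apply derivative.ext
    · rw [Derivation.leibniz, derivative_inv', hF', hG']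
      have : G * G⁻¹ = 1 := PowerSeries.mul_inv_cancel G hG0
      simp only [smul_eq_mul, Derivation.map_one_eq_zero]
      linear_combination (- F * R * G⁻¹) * this
    · simp [hF, hG]
  calc F = F * (G⁻¹ * G) := by rw [PowerSeries.inv_mul_cancel G hG0, mul_one]
    _ = G := by rw [← mul_assoc, h1, one_mul]

/-- The power series `∑_{n ≥ 1} t n X ^ n`. -/
noncomputable def tailSeries (t : ℕ → ℂ) : PowerSeries ℂ :=
  PowerSeries.mk fun n ↦ if n = 0 then 0 else t n

/-- The formal exponential of `∑_{n ≥ 1} t n / n X ^ n`. -/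
noncomputable def expTrace (t : ℕ → ℂ) : PowerSeries ℂ :=
  formalExp (PowerSeries.mk fun n ↦ if n = 0 then 0 else (1 / (n : ℂ)) * t n)

open PowerSeries in
theorem coeff_X_mul_derivative (F : PowerSeries ℂ) (n : ℕ) :
    coeff n (X * d⁄dX ℂ F) = n * coeff n F := by
  cases n with
  | zero => simp
  | succ n => rw [coeff_succ_X_mul, coeff_derivative]; push_cast; ring

open PowerSeries in
theorem X_mul_derivative_mk_div (t : ℕ → ℂ) :
    X * d⁄dX ℂ (PowerSeries.mk fun n ↦ if n = 0 then 0 else (1 / (n : ℂ)) * t n) =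
      tailSeries t := by
  ext n
  rw [coeff_X_mul_derivative, tailSeries, coeff_mk, coeff_mk]
  split_ifs with h
  · simp
  · have : (n : ℂ) ≠ 0 := by exact_mod_cast h
    field_simp

open PowerSeries in
theorem constantCoeff_expTrace (t : ℕ → ℂ) : constantCoeff (expTrace t) = 1 :=
  constantCoeff_formalExp (by rw [← coeff_zero_eq_constantCoeff_apply]; simp)

open PowerSeries in
theorem X_mul_derivative_expTrace (t : ℕ → ℂ) :
    X * d⁄dX ℂ (expTrace t) = expTrace t * tailSeries t := by
  rw [expTrace, derivative_formalExp, ← X_mul_derivative_mk_div]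
  · ring
  · rw [← coeff_zero_eq_constantCoeff_apply]; simp

-- The operator X d/dX turns the coefficients t n / n of a logarithm into the traces t n themselves,
-- and X can be cancelled because power series over ℂ form a domain.
open PowerSeries in
theorem eq_of_X_mul_derivative_eq_mul {F G R : PowerSeries ℂ} (hF : constantCoeff F = 1)
    (hG : constantCoeff G = 1) (hF' : X * d⁄dX ℂ F = F * R) (hG' : X * d⁄dX ℂ G = G * R) :
    F = G := by
  have hG0 : constantCoeff G ≠ 0 := by simp [hG]
  have e : G⁻¹ * G = 1 := PowerSeries.inv_mul_cancel G hG0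
  have hR : R = X * (G⁻¹ * d⁄dX ℂ G) := by
    linear_combination (-R) * e - G⁻¹ * hG'
  refine eq_of_derivative_eq_mul (R := G⁻¹ * d⁄dX ℂ G) hF hG ?_ ?_
  · refine mul_left_cancel₀ X_ne_zero (hF'.trans ?_)
    nth_rw 1 [hR]; ring
  · linear_combination (-d⁄dX ℂ G) * e

-- The working principle for all identities about `expTrace`: checking one logarithmic derivative
-- suffices.
open PowerSeries in
theorem expTrace_eq {t : ℕ → ℂ} {F : PowerSeries ℂ} (hF : constantCoeff F = 1)
    (h : X * d⁄dX ℂ F = F * tailSeries t) : expTrace t = F :=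
  eq_of_X_mul_derivative_eq_mul (constantCoeff_expTrace t) hF (X_mul_derivative_expTrace t) h

open PowerSeries in
theorem expTrace_add (s t : ℕ → ℂ) : expTrace (s + t) = expTrace s * expTrace t := by
  apply expTrace_eq
  · simp [constantCoeff_expTrace]
  · have hst : tailSeries (s + t) = tailSeries s + tailSeries t := by
      ext n
      simp only [tailSeries, coeff_mk, map_add, Pi.add_apply]
      split_ifs <;> simp
    rw [Derivation.leibniz, hst, smul_eq_mul, smul_eq_mul]
    linear_combination expTrace s * X_mul_derivative_expTrace t +
      expTrace t * X_mul_derivative_expTrace s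

open PowerSeries in
theorem expTrace_zero : expTrace 0 = 1 := by
  apply expTrace_eq
  · simp
  · have : tailSeries 0 = 0 := by ext n; simp [tailSeries]
    rw [this]
    simp [Derivation.map_one_eq_zero]

theorem expTrace_sum {ι : Type*} (s : Finset ι) (t : ι → ℕ → ℂ) :
    expTrace (∑ i ∈ s, t i) = ∏ i ∈ s, expTrace (t i) := by
  classical
  induction s using Finset.induction_on with
  | empty => simpa using expTrace_zero
  | insert a s ha ih => rw [Finset.sum_insert ha, Finset.prod_insert ha, expTrace_add, ih]

theorem expTrace_nsmul (m : ℕ) (t : ℕ → ℂ) : expTrace (m • t) = expTrace t ^ m := by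
  induction m with
  | zero => simpa using expTrace_zero
  | succ m ih => rw [succ_nsmul, expTrace_add, ih, pow_succ]

open PowerSeries in
theorem expTrace_neg (t : ℕ → ℂ) : expTrace (-t) = (expTrace t)⁻¹ := by
  have h0 : constantCoeff (expTrace t) ≠ 0 := by simp [constantCoeff_expTrace]
  rw [PowerSeries.eq_inv_iff_mul_eq_one h0, ← expTrace_add, neg_add_cancel, expTrace_zero]

open PowerSeries in
theorem rescale_expTrace (a : ℂ) (t : ℕ → ℂ) :
    rescale a (expTrace t) = expTrace fun n ↦ a ^ n * t n := by
  symm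
  apply expTrace_eq
  · rw [← coeff_zero_eq_constantCoeff_apply, coeff_rescale, coeff_zero_eq_constantCoeff_apply,
      constantCoeff_expTrace]; simp
  · have : tailSeries (fun n ↦ a ^ n * t n) = rescale a (tailSeries t) := by
      ext n
      simp only [tailSeries, coeff_mk, coeff_rescale]
      split_ifs <;> simp
    rw [this, ← map_mul, ← X_mul_derivative_expTrace]
    ext n
    simp only [coeff_rescale, coeff_X_mul_derivative]
    ring

open PowerSeries Filter in
/-- The coefficients of `expTrace t` depend continuously on `t`. -/
theorem tendsto_coeff_expTrace {t : ℕ → ℕ → ℂ} {t' : ℕ → ℂ}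
    (h : ∀ n ≠ 0, Tendsto (fun N ↦ t N n) atTop (𝓝 (t' n))) (n : ℕ) :
    Tendsto (fun N ↦ coeff n (expTrace (t N))) atTop (𝓝 (coeff n (expTrace t'))) := by
  induction n using Nat.strong_induction_on with
  | _ n ih =>
    -- The coefficient of order n is a polynomial in the lower coefficients and in t 1, ..., t n:
    -- the pair with second index 0 drops out of this recursion, so strong induction applies.
    have key (s : ℕ → ℂ) : (n : ℂ) * coeff n (expTrace s) =
        ∑ q ∈ Finset.HasAntidiagonal.antidiagonal n,
          coeff q.1 (expTrace s) * coeff q.2 (tailSeries s) := by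
      rw [← coeff_X_mul_derivative, X_mul_derivative_expTrace, coeff_mul]
    rcases Nat.eq_zero_or_pos n with rfl | hn
    · simp [constantCoeff_expTrace]
    · have hn' : (n : ℂ) ≠ 0 := by exact_mod_cast hn.ne'
      have key' (s : ℕ → ℂ) : coeff n (expTrace s) = (n : ℂ)⁻¹ *
          ∑ q ∈ Finset.HasAntidiagonal.antidiagonal n,
            coeff q.1 (expTrace s) * coeff q.2 (tailSeries s) := by
        rw [← key, inv_mul_cancel_left₀ hn']
      simp only [key' (t _), key' t']
      refine Tendsto.const_mul _ (tendsto_finsetSum _ fun q hq ↦ ?_)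
      have hq' := Finset.HasAntidiagonal.mem_antidiagonal.1 hq
      rcases Nat.eq_zero_or_pos q.2 with h2 | h2
      · simp [tailSeries, h2]
      · refine (ih q.1 (by omega)).mul ?_
        simpa [tailSeries, h2.ne'] using h q.2 h2.ne'

/-! ### Weighted counts of cyclic words. -/

/-- The position of the first `true` in the word `a` followed by `k` times `false` and a `true`. -/
def leadingFalse : (n : ℕ) → (Fin n → Bool) → ℕ → ℕ
  | 0, _, k => k
  | n + 1, a, k => if a 0 then 0 else leadingFalse n (Fin.tail a) k + 1

/-- The weight of the word `a` followed by `k` times `false` and a `true`: each `true` in `a`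
followed by exactly `l` times `false` counts for a factor `w l`. -/
def wordWeight (w : ℕ → ℂ) : (n : ℕ) → (Fin n → Bool) → ℕ → ℂ
  | 0, _, _ => 1
  | n + 1, a, k =>
    (if a 0 then w (leadingFalse n (Fin.tail a) k) else 1) * wordWeight w n (Fin.tail a) k

/-- The weight of the word `a`, seen as a cyclic word. -/
def cyclicWeight (w : ℕ → ℂ) (n : ℕ) (a : Fin n → Bool) : ℂ :=
  if ∀ i, a i = false then 1 else wordWeight w n a (leadingFalse n a 0)

theorem leadingFalse_le (n : ℕ) (a : Fin n → Bool) (k : ℕ) : leadingFalse n a k ≤ n + k := by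
  induction n with
  | zero => simp [leadingFalse]
  | succ n ih =>
    rw [leadingFalse]
    split_ifs
    · omega
    · have := ih (Fin.tail a); omega

theorem leadingFalse_eq (n : ℕ) (a : Fin n → Bool) (ha : ∀ i, a i = false) (k : ℕ) :
    leadingFalse n a k = n + k := by
  induction n with
  | zero => simp [leadingFalse]
  | succ n ih =>
    rw [leadingFalse, ih (Fin.tail a) fun i ↦ ha _]
    simp [ha]; omega

/-- As soon as a word contains a `true`, the padding after it is never reached. This is why 0 may
serve as padding in `cyclicWeight`. -/
theorem leadingFalse_lt (n : ℕ) (a : Fin n → Bool) (ha : ¬ ∀ i, a i = false) (k : ℕ) :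
    leadingFalse n a k < n ∧ leadingFalse n a k = leadingFalse n a 0 := by
  induction n with
  | zero => exact absurd (fun i ↦ i.elim0) ha
  | succ n ih =>
    rw [leadingFalse, leadingFalse]
    by_cases h0 : a 0
    · simp [h0]
    · have : ¬ ∀ i, Fin.tail a i = false := by
        intro h
        refine ha fun i ↦ ?_
        refine Fin.cases ?_ (fun j ↦ ?_) i
        · simpa using h0
        · exact h j
      have := ih _ this
      simp only [h0]
      constructor
      · simpa using this.1
      · simpa using this.2

/-- The weighted count of words of length `n` followed by `k` times `false` and a `true`, whose
first `true` is at the position `l`. -/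
def wordSum (w : ℕ → ℂ) (n k l : ℕ) : ℂ :=
  ∑ a : Fin n → Bool, if leadingFalse n a k = l then wordWeight w n a k else 0

theorem sum_words_succ {n : ℕ} (f : (Fin (n + 1) → Bool) → ℂ) :
    ∑ a, f a = (∑ a : Fin n → Bool, f (Fin.cons true a)) +
      ∑ a : Fin n → Bool, f (Fin.cons false a) := by
  rw [← (Fin.consEquiv fun _ : Fin (n + 1) ↦ Bool).sum_comp, Fintype.sum_prod_type]
  simp [Fin.consEquiv]

section

variable (w : ℕ → ℂ)

theorem wordSum_zero (k l : ℕ) : wordSum w 0 k l = if k = l then 1 else 0 := by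
  by_cases h : k = l <;> simp [wordSum, leadingFalse, wordWeight, h]

theorem wordSum_succ_succ (n k l : ℕ) : wordSum w (n + 1) k (l + 1) = wordSum w n k l := by
  rw [wordSum, sum_words_succ]
  simp [leadingFalse, wordWeight, wordSum, Fin.tail_cons]

theorem wordSum_succ_zero (n k : ℕ) :
    wordSum w (n + 1) k 0 = ∑ l ∈ Finset.range (n + k + 1), w l * wordSum w n k l := by
  rw [wordSum, sum_words_succ]
  simp only [leadingFalse, wordWeight, Fin.tail_cons, Fin.cons_zero, wordSum, Finset.mul_sum]
  rw [Finset.sum_comm]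
  simp only [mul_ite, mul_zero, Finset.sum_ite_eq]
  simp only [reduceIte, Finset.mem_range, Nat.lt_succ_iff, leadingFalse_le]
  simp

theorem wordSum_add (n k l : ℕ) (j : ℕ) : wordSum w (n + j) k (l + j) = wordSum w n k l := by
  induction j with
  | zero => rfl
  | succ j ih => rw [← add_assoc, ← add_assoc, wordSum_succ_succ, ih]

/-- Cut the word at its second `true`. Either it comes after l < n times `false`, leaving a shorter
word that again starts with `true`, or the rest of the word is `false` and the run ends only after
the padding, at length n + k. -/
theorem wordSum_renewal (n k : ℕ) : wordSum w (n + 1) k 0 =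
    ∑ l ∈ Finset.range n, w l * wordSum w (n - l) k 0 + w (n + k) := by
  rw [wordSum_succ_zero, add_assoc, Finset.sum_range_add]
  congr 1
  · refine Finset.sum_congr rfl fun l hl ↦ ?_
    rw [Finset.mem_range] at hl
    have := wordSum_add w (n - l) k 0 l
    rw [Nat.sub_add_cancel hl.le, zero_add] at this
    rw [this]
  · rw [Finset.sum_eq_single k]
    · rw [add_comm n k, ← zero_add n, ← add_assoc, wordSum_add, wordSum_zero]; simp
    · intro j _ hj
      conv_lhs => rw [show wordSum w n k (n + j) = wordSum w (0 + n) k (j + n) by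
        rw [zero_add, add_comm n j]]
      rw [wordSum_add, wordSum_zero, if_neg hj.symm, mul_zero]
    · simp

/-- The weighted count of the nonzero cyclic words of length `n`. -/
def cyclicSum (n : ℕ) : ℂ := ∑ l ∈ Finset.range n, wordSum w n l l

/-- Leading `false` letters carry no weight, so the l of them can be removed; cyclically they extend
the last run, hence the padding l. -/
theorem cyclicSum_eq (n : ℕ) : cyclicSum w n = ∑ l ∈ Finset.range n, wordSum w (n - l) l 0 := by
  refine Finset.sum_congr rfl fun l hl ↦ ?_
  rw [Finset.mem_range] at hl
  conv_lhs => rw [show wordSum w n l l = wordSum w ((n - l) + l) l (0 + l) by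
    rw [Nat.sub_add_cancel hl.le, zero_add]]
  rw [wordSum_add]

/-- The renewal equation is summed over the number l of leading `false` letters; each of the n + 1
values of l contributes one boundary term `w n`. -/
theorem cyclicSum_renewal (n : ℕ) : cyclicSum w (n + 1) =
    ∑ j ∈ Finset.range n, w j * cyclicSum w (n - j) + (n + 1) * w n := by
  have h1 : ∀ l ∈ Finset.range (n + 1), wordSum w (n + 1 - l) l 0 =
      ∑ j ∈ Finset.range (n - l), w j * wordSum w (n - l - j) l 0 + w n := by
    intro l hl
    rw [Finset.mem_range] at hl
    rw [show n + 1 - l = (n - l) + 1 by omega, wordSum_renewal, show n - l + l = n by omega]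
  rw [cyclicSum_eq, Finset.sum_congr rfl h1, Finset.sum_add_distrib]
  simp only [Finset.sum_const, Finset.card_range, nsmul_eq_mul, cyclicSum_eq, Finset.mul_sum]
  push_cast
  congr 1
  rw [Finset.sum_sigma', Finset.sum_sigma']
  -- Both double sums run over the pairs with l + j < n, in the two orders.
  refine Finset.sum_bij' (fun x _ ↦ ⟨x.2, x.1⟩) (fun x _ ↦ ⟨x.2, x.1⟩) ?_ ?_ ?_ ?_ ?_
  · simp only [Finset.mem_sigma, Finset.mem_range]; intros; omega
  · simp only [Finset.mem_sigma, Finset.mem_range]; intros; omega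
  · simp
  · simp
  · intro x _
    rw [Nat.sub_right_comm]

/-- A word containing a `true` satisfies the condition `leadingFalse n a l = l` for exactly one l <
n, and the all-`false` word for none; the latter is the summand 1. -/
theorem sum_cyclicWeight (n : ℕ) :
    ∑ a : Fin n → Bool, cyclicWeight w n a = 1 + cyclicSum w n := by
  have h1 (a : Fin n → Bool) : cyclicWeight w n a = (if a = fun _ ↦ false then 1 else 0) +
      ∑ l ∈ Finset.range n, if leadingFalse n a l = l then wordWeight w n a l else 0 := by
    rw [cyclicWeight]
    split_ifs with h h' h'
    · rw [Finset.sum_eq_zero, add_zero]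
      intro l hl
      rw [leadingFalse_eq n a h, if_neg]
      have := Finset.mem_range.1 hl; omega
    · exact absurd (funext h) h'
    · exact absurd (fun i ↦ congrFun h' i) h
    · rw [zero_add, Finset.sum_eq_single (leadingFalse n a 0)]
      · rw [if_pos (leadingFalse_lt n a h _).2]
      · intro l _ hl
        rw [if_neg]
        rw [(leadingFalse_lt n a h _).2]
        exact hl.symm
      · intro h'
        exact absurd (Finset.mem_range.2 (leadingFalse_lt n a h 0).1) h'
  simp only [h1, Finset.sum_add_distrib, cyclicSum, wordSum]
  rw [Finset.sum_comm]
  simp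

-- The renewal equation in generating function form, C = W C + X W' with W = X ∑ w k X^k.
open PowerSeries in
theorem one_sub_mul_tailSeries_cyclicSum :
    (1 - X * PowerSeries.mk w) * tailSeries (cyclicSum w) = X * d⁄dX ℂ (X * PowerSeries.mk w) := by
  ext n
  rw [coeff_X_mul_derivative]
  cases n with
  | zero => simp [tailSeries]
  | succ n =>
    rw [sub_mul, one_mul, map_sub, mul_assoc, coeff_succ_X_mul, coeff_succ_X_mul, coeff_mul,
      Finset.Nat.sum_antidiagonal_eq_sum_range_succ_mk, Finset.sum_range_succ]
    simp only [coeff_mk, tailSeries, Nat.sub_self, reduceIte, mul_zero, add_zero]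
    have h : ∀ j ∈ Finset.range n, (w j * if n - j = 0 then 0 else cyclicSum w (n - j)) =
        w j * cyclicSum w (n - j) := fun j hj ↦ by
      rw [if_neg (by have := Finset.mem_range.1 hj; omega)]
    rw [if_neg (Nat.succ_ne_zero n), Finset.sum_congr rfl h, cyclicSum_renewal]
    push_cast; ring

open PowerSeries in
theorem one_sub_X_mul_mk_one : (1 - X : PowerSeries ℂ) * PowerSeries.mk (fun _ ↦ 1) = 1 := by
  rw [mul_comm]; exact PowerSeries.mk_one_mul_one_sub_eq_one ℂ

/-- The power series `1 - 2 X - X (1 - X) ∑ α k X ^ k`. -/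
noncomputable def zetaInverse (α : ℕ → ℂ) : PowerSeries ℂ :=
  1 - 2 * PowerSeries.X - PowerSeries.X * (1 - PowerSeries.X) * PowerSeries.mk α

open PowerSeries in
/-- The trace formula: a full shift weighted by `1 + α k` at each `true` followed by exactly `k`
times `false` has a zeta function with inverse `1 - 2 X - X (1 - X) ∑ α k X ^ k`. -/
theorem expTrace_sum_cyclicWeight (α : ℕ → ℂ) :
    (expTrace fun n ↦ ∑ a : Fin n → Bool, cyclicWeight (fun k ↦ 1 + α k) n a)⁻¹ =
      zetaInverse α := by
  rw [← expTrace_neg, zetaInverse]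
  set W : PowerSeries ℂ := X * PowerSeries.mk fun k ↦ 1 + α k with hW
  have h1 := one_sub_X_mul_mk_one
  have hWα : W = X * PowerSeries.mk (fun _ ↦ 1) + X * PowerSeries.mk α := by
    rw [hW, ← mul_add]; congr 1
  -- The factor 1 - X is the contribution of the all-`false` word, and 1 - W that of all other
  -- words.
  have hP : 1 - 2 * X - X * (1 - X) * PowerSeries.mk α = (1 - X) * (1 - W) := by
    rw [hWα]; linear_combination X * h1
  have hT : tailSeries (-fun n ↦ ∑ a : Fin n → Bool, cyclicWeight (fun k ↦ 1 + α k) n a) =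
      -(X * PowerSeries.mk (fun _ ↦ 1)) - tailSeries (cyclicSum fun k ↦ 1 + α k) := by
    ext n
    cases n with
    | zero => simp [tailSeries]
    | succ n =>
      rw [map_sub, map_neg, coeff_succ_X_mul]
      simp [tailSeries, sum_cyclicWeight]; ring
  have hr := one_sub_mul_tailSeries_cyclicSum fun k ↦ 1 + α k
  rw [← hW] at hr
  rw [hP]
  apply expTrace_eq
  · simp [hW]
  · rw [hT, Derivation.leibniz, map_sub, map_sub, Derivation.map_one_eq_zero, derivative_X]
    simp only [smul_eq_mul]
    linear_combination (1 - X) * hr + X * (1 - W) * h1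

end

/-! ### Sums of power series and their locally uniform limits. -/

theorem seriesTerm_mul (F G : PowerSeries ℂ) (z : ℂ) (n : ℕ) : seriesTerm (F * G) z n =
    ∑ q ∈ Finset.HasAntidiagonal.antidiagonal n, seriesTerm F z q.1 * seriesTerm G z q.2 := by
  rw [seriesTerm, PowerSeries.coeff_mul, Finset.sum_mul]
  refine Finset.sum_congr rfl fun q hq ↦ ?_
  rw [← Finset.HasAntidiagonal.mem_antidiagonal.1 hq, pow_add, seriesTerm, seriesTerm]
  ring

theorem summable_seriesTerm_mul {F G : PowerSeries ℂ} {z : ℂ} (hF : Summable (seriesTerm F z))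
    (hG : Summable (seriesTerm G z)) : Summable (seriesTerm (F * G) z) := by
  have := summable_norm_sum_mul_antidiagonal_of_summable_norm hF.norm hG.norm
  simpa only [← seriesTerm_mul] using this.of_norm

theorem seriesSum_mul {F G : PowerSeries ℂ} {z : ℂ} (hF : Summable (seriesTerm F z))
    (hG : Summable (seriesTerm G z)) : seriesSum (F * G) z = seriesSum F z * seriesSum G z := by
  have := tsum_mul_tsum_eq_tsum_sum_antidiagonal_of_summable_norm hF.norm hG.norm
  simp only [← seriesTerm_mul] at this
  exact this.symm

theorem seriesTerm_one (z : ℂ) : seriesTerm 1 z = fun n ↦ if n = 0 then 1 else 0 := by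
  ext n
  rw [seriesTerm, PowerSeries.coeff_one]
  split_ifs with h <;> simp [h]

theorem hasSum_seriesTerm_one (z : ℂ) : HasSum (seriesTerm 1 z) 1 := by
  rw [seriesTerm_one]; exact hasSum_ite_eq 0 1

theorem seriesTerm_prod {ι : Type*} (s : Finset ι) (F : ι → PowerSeries ℂ) {z : ℂ}
    (hF : ∀ i ∈ s, Summable (seriesTerm (F i) z)) :
    Summable (seriesTerm (∏ i ∈ s, F i) z) ∧
      seriesSum (∏ i ∈ s, F i) z = ∏ i ∈ s, seriesSum (F i) z := by
  classical
  induction s using Finset.induction_on with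
  | empty => simpa using ⟨(hasSum_seriesTerm_one z).summable, (hasSum_seriesTerm_one z).tsum_eq⟩
  | insert a s ha ih =>
    obtain ⟨h1, h2⟩ := ih fun i hi ↦ hF i (Finset.mem_insert_of_mem hi)
    have h3 := hF a (Finset.mem_insert_self a s)
    rw [Finset.prod_insert ha, Finset.prod_insert ha]
    exact ⟨summable_seriesTerm_mul h3 h1, by rw [seriesSum_mul h3 h1, h2]⟩

theorem seriesTerm_pow (F : PowerSeries ℂ) {z : ℂ} (hF : Summable (seriesTerm F z)) (m : ℕ) :
    Summable (seriesTerm (F ^ m) z) ∧ seriesSum (F ^ m) z = seriesSum F z ^ m := by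
  simpa using seriesTerm_prod (Finset.range m) (fun _ ↦ F) fun _ _ ↦ hF

theorem seriesTerm_rescale (a : ℂ) (F : PowerSeries ℂ) (z : ℂ) :
    seriesTerm (PowerSeries.rescale a F) z = seriesTerm F (a * z) := by
  ext n
  rw [seriesTerm, seriesTerm, PowerSeries.coeff_rescale, mul_pow]; ring

theorem seriesSum_rescale (a : ℂ) (F : PowerSeries ℂ) (z : ℂ) :
    seriesSum (PowerSeries.rescale a F) z = seriesSum F (a * z) := by
  rw [seriesSum, seriesTerm_rescale, seriesSum]

theorem hasFPowerSeriesOnBall_seriesSum {F : PowerSeries ℂ} {R : ℝ≥0∞} (hR : 0 < R)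
    (hF : ∀ z : ℂ, ‖z‖ₑ < R → Summable (seriesTerm F z)) :
    HasFPowerSeriesOnBall (seriesSum F)
      (FormalMultilinearSeries.ofScalars ℂ fun n ↦ PowerSeries.coeff n F) 0 R where
  r_le := by
    refine ENNReal.le_of_forall_nnreal_lt fun r hr ↦ ?_
    apply FormalMultilinearSeries.le_radius_of_summable_norm
    have := (hF ((r : ℝ) : ℂ) (by simpa [enorm] using hr)).norm
    simpa [seriesTerm, FormalMultilinearSeries.ofScalars_norm] using this
  r_pos := hR
  hasSum := by
    intro z hz
    have hz' : ‖z‖ₑ < R := by simpa using hz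
    have := (hF z hz').hasSum
    rw [zero_add]
    refine this.congr_fun fun n ↦ ?_
    rw [seriesTerm, FormalMultilinearSeries.ofScalars_apply_eq, smul_eq_mul]

theorem setOf_enorm_lt_eq (R : ℝ≥0∞) : {z : ℂ | ‖z‖ₑ < R} = Metric.eball 0 R := by
  ext z; simp

theorem iteratedDeriv_seriesSum {F : PowerSeries ℂ} {R : ℝ≥0∞} (hR : 0 < R)
    (hF : ∀ z : ℂ, ‖z‖ₑ < R → Summable (seriesTerm F z)) (n : ℕ) :
    iteratedDeriv n (seriesSum F) 0 = (n.factorial : ℂ) * PowerSeries.coeff n F := by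
  have := (hasFPowerSeriesOnBall_seriesSum hR hF).factorial_smul 1 n
  rw [iteratedDeriv_eq_iteratedFDeriv, ← this]
  simp

-- Weierstrass's theorem for derivatives, iterated.
open Filter in
theorem tendstoLocallyUniformlyOn_iteratedDeriv {ι : Type*} {φ : Filter ι}
    {F : ι → ℂ → ℂ} {f : ℂ → ℂ} {U : Set ℂ} (hU : IsOpen U)
    (h : TendstoLocallyUniformlyOn F f φ U) (hF : ∀ i, DifferentiableOn ℂ (F i) U) (n : ℕ) :
    TendstoLocallyUniformlyOn (fun i ↦ iteratedDeriv n (F i)) (iteratedDeriv n f) φ U ∧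
      ∀ i, DifferentiableOn ℂ (iteratedDeriv n (F i)) U := by
  induction n with
  | zero => simpa [iteratedDeriv_zero] using ⟨h, hF⟩
  | succ n ih =>
    simp only [iteratedDeriv_succ]
    exact ⟨ih.1.deriv (Eventually.of_forall ih.2) hU, fun i ↦ (ih.2 i).deriv hU⟩

open Filter in
/-- If the sums of power series converge locally uniformly on a disc and their coefficients
converge, then the limit function is the sum of the limit power series. -/
theorem hasSum_seriesTerm_of_tendsto {D : ℕ → PowerSeries ℂ} {d : PowerSeries ℂ} {f : ℂ → ℂ}
    {R : ℝ≥0∞} (hR : 0 < R) (hD : ∀ N, ∀ z : ℂ, ‖z‖ₑ < R → Summable (seriesTerm (D N) z))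
    (hf : TendstoLocallyUniformlyOn (fun N ↦ seriesSum (D N)) f atTop {z : ℂ | ‖z‖ₑ < R})
    (hd : ∀ n, Tendsto (fun N ↦ PowerSeries.coeff n (D N)) atTop (𝓝 (PowerSeries.coeff n d)))
    {z : ℂ} (hz : ‖z‖ₑ < R) : HasSum (seriesTerm d z) (f z) := by
  rw [setOf_enorm_lt_eq] at hf
  have hdiff (N : ℕ) : DifferentiableOn ℂ (seriesSum (D N)) (Metric.eball 0 R) :=
    (hasFPowerSeriesOnBall_seriesSum hR (hD N)).differentiableOn
  have hfd := hf.differentiableOn (Eventually.of_forall hdiff) Metric.isOpen_eball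
  -- The Taylor coefficients of the limit are the limits of the Taylor coefficients, which are known
  -- formally; this identifies the analytic limit with the formal one.
  have key (n : ℕ) : iteratedDeriv n f 0 = (n.factorial : ℂ) * PowerSeries.coeff n d := by
    have h1 := (tendstoLocallyUniformlyOn_iteratedDeriv Metric.isOpen_eball hf hdiff n).1.tendsto_at
      (Metric.mem_eball_self hR)
    simp only [iteratedDeriv_seriesSum hR (hD _)] at h1
    exact tendsto_nhds_unique h1 ((hd n).const_mul _)
  have := Complex.hasSum_taylorSeries_on_eball hfd (z := z) (by simpa using hz)
  refine HasSum.congr_fun this fun n ↦ ?_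
  have hn : (n.factorial : ℂ) ≠ 0 := by exact_mod_cast n.factorial_ne_zero
  rw [key, seriesTerm, sub_zero, smul_eq_mul, smul_eq_mul]
  field_simp

theorem summable_exp_sub_one {x : ℕ → ℝ} (hx : Summable x) (h0 : ∀ k, 0 ≤ x k) :
    Summable fun k ↦ Real.exp (x k) - 1 := by
  refine Summable.of_nonneg_of_le (fun k ↦ ?_) (fun k ↦ ?_)
    (hx.mul_right (Real.exp (∑' k, x k)))
  · linarith [Real.add_one_le_exp (x k), h0 k]
  · have h1 : Real.exp (x k) - 1 ≤ x k * Real.exp (x k) := by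
      have := Real.add_one_le_exp (-x k)
      have h2 : Real.exp (-x k) * Real.exp (x k) = 1 := by rw [← Real.exp_add]; simp
      nlinarith [Real.exp_pos (x k)]
    refine h1.trans (mul_le_mul_of_nonneg_left (Real.exp_le_exp.2 ?_) (h0 k))
    exact hx.le_tsum k fun j _ ↦ h0 j

theorem norm_one_add_pow_sub_one_le (a : ℂ) (m : ℕ) :
    ‖(1 + a) ^ m - 1‖ ≤ Real.exp (m * ‖a‖) - 1 := by
  simpa using Finset.norm_prod_one_add_sub_one_le (Finset.range m) fun _ ↦ a

theorem seriesSum_zero (F : PowerSeries ℂ) : seriesSum F 0 = PowerSeries.constantCoeff F := by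
  rw [seriesSum, tsum_eq_single 0]
  · simp [seriesTerm]
  · intro n hn; simp [seriesTerm, hn]

/-- A convergent power series with constant term `1` is `1 + O(w)`. -/
theorem exists_norm_seriesSum_sub_one_le {F : PowerSeries ℂ} (h0 : PowerSeries.constantCoeff F = 1)
    {r : ℝ} (hr : 0 ≤ r) (hF : Summable (seriesTerm F r)) :
    ∃ C, 0 ≤ C ∧ ∀ w : ℂ, ‖w‖ ≤ r → ‖seriesSum F w - 1‖ ≤ C * ‖w‖ := by
  rcases hr.eq_or_lt with rfl | hr
  · refine ⟨0, le_rfl, fun w hw ↦ ?_⟩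
    have : w = 0 := by simpa using hw
    simp [this, seriesSum_zero, h0]
  · have hn := hF.norm
    have hn1 : Summable fun n ↦ ‖PowerSeries.coeff (n + 1) F‖ * r ^ n := by
      have := ((summable_nat_add_iff 1).2 hn).mul_right r⁻¹
      refine this.congr fun n ↦ ?_
      simp only [seriesTerm, norm_mul, norm_pow, Complex.norm_real, Real.norm_eq_abs,
        abs_of_pos hr]
      field_simp
      ring
    refine ⟨∑' n, ‖PowerSeries.coeff (n + 1) F‖ * r ^ n, tsum_nonneg fun n ↦ by positivity,
      fun w hw ↦ ?_⟩
    have hterm (n : ℕ) : ‖seriesTerm F w (n + 1)‖ ≤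
        ‖PowerSeries.coeff (n + 1) F‖ * r ^ n * ‖w‖ := by
      rw [seriesTerm, norm_mul, norm_pow, pow_succ, mul_assoc]
      gcongr
    have hs : Summable fun n ↦ seriesTerm F w (n + 1) :=
      Summable.of_norm_bounded (hn1.mul_right _) hterm
    have hw' : Summable (seriesTerm F w) := (summable_nat_add_iff 1).1 hs
    rw [seriesSum, hw'.tsum_eq_zero_add, ← tsum_mul_right]
    have : seriesTerm F w 0 = 1 := by simp [seriesTerm, h0]
    rw [this, add_sub_cancel_left]
    exact tsum_of_norm_bounded (hn1.mul_right _).hasSum hterm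

/-! ### The infinite product for the dynamical determinant. -/

theorem mul_div_six_eq_choose (k : ℕ) : (k + 1) * (k + 2) * (k + 3) / 6 = (k + 3).choose 3 := by
  rw [Nat.choose_eq_descFactorial_div_factorial]
  simp [Nat.descFactorial, Nat.factorial]
  ring_nf

/-- The largest of the rescaled points is the one for k = 0, at z / 16. -/
theorem div_four_pow_mem {R : ℝ≥0∞} {z : ℂ} (hz : ‖z‖ₑ < 16 * R) (k : ℕ) :
    ‖((4 ^ (k + 2))⁻¹ : ℂ) * z‖ₑ < R := by
  have h1 : ‖((4 ^ (k + 2))⁻¹ : ℂ) * z‖ₑ ≤ ‖((16 : ℂ)⁻¹ * z)‖ₑ := by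
    rw [enorm_le_iff_norm_le, norm_mul, norm_mul]
    gcongr
    simp only [norm_inv, norm_pow, Complex.norm_ofNat]
    gcongr
    rw [pow_add]
    have := one_le_pow₀ (M₀ := ℝ) (a := 4) (by norm_num) (n := k)
    linarith
  refine h1.trans_lt ?_
  rw [enorm_mul, mul_comm]
  have h16 : ‖(16 : ℂ)⁻¹‖ₑ = (16 : ℝ≥0∞)⁻¹ := by
    rw [enorm_inv (by norm_num)]; simp [enorm]
  rw [h16, ← div_eq_mul_inv]
  exact ENNReal.div_lt_of_lt_mul' hz

open Filter in
/-- The infinite product of the rescalings of a power series `P` with multiplicities converges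
locally uniformly to the sum of the exponential of the correspondingly weighted traces. -/
theorem hasProdLocallyUniformlyOn_expTrace {t f : ℕ → ℂ} {R : ℝ≥0∞} (hR : 0 < R)
    (hP : ∀ z : ℂ, ‖z‖ₑ < R → Summable (seriesTerm (expTrace t) z))
    (hf : ∀ n ≠ 0, HasSum (fun k : ℕ ↦
      ((k + 3).choose 3 : ℂ) * (((4 ^ (k + 2))⁻¹ : ℂ) ^ n * t n)) (f n)) :
    (∀ z : ℂ, ‖z‖ₑ < 16 * R → Summable (seriesTerm (expTrace f) z)) ∧
    HasProdLocallyUniformlyOn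
      (fun (k : ℕ) (z : ℂ) ↦ seriesSum (expTrace t) (z / 4 ^ (k + 2)) ^
        ((k + 1) * (k + 2) * (k + 3) / 6))
      (seriesSum (expTrace f)) {z : ℂ | ‖z‖ₑ < 16 * R} := by
  set P := expTrace t with hPt
  set a : ℕ → ℂ := fun k ↦ (4 ^ (k + 2))⁻¹ with ha
  set U : Set ℂ := {z : ℂ | ‖z‖ₑ < 16 * R} with hU
  have hUo : IsOpen U := by rw [hU, setOf_enorm_lt_eq]; exact Metric.isOpen_eball
  set E : ℕ → PowerSeries ℂ := fun k ↦ PowerSeries.rescale (a k) P ^ (k + 3).choose 3 with hE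
  have hEs (k : ℕ) {z : ℂ} (hz : ‖z‖ₑ < 16 * R) : Summable (seriesTerm (E k) z) ∧
      seriesSum (E k) z = seriesSum P (a k * z) ^ (k + 3).choose 3 := by
    have := seriesTerm_pow (PowerSeries.rescale (a k) P) (z := z)
      (by rw [seriesTerm_rescale]; exact hP _ (div_four_pow_mem hz k)) ((k + 3).choose 3)
    rwa [seriesSum_rescale] at this
  have hR' : 0 < 16 * R := ENNReal.mul_pos (by norm_num) hR.ne'
  have hcont (k : ℕ) : ContinuousOn (seriesSum (E k)) U := by
    rw [hU, setOf_enorm_lt_eq]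
    exact (hasFPowerSeriesOnBall_seriesSum hR' fun z hz ↦ (hEs k hz).1).continuousOn
  -- convergence of the product
  have hprod : HasProdLocallyUniformlyOn (fun k z ↦ seriesSum (E k) z)
      (fun z ↦ ∏' k, seriesSum (E k) z) U := by
    refine hasProdLocallyUniformlyOn_of_forall_compact hUo fun K hKU hK ↦ ?_
    rcases K.eq_empty_or_nonempty with rfl | hne
    · rw [hasProdUniformlyOn_iff_tendstoUniformlyOn]
      exact tendstoUniformlyOn_empty
    obtain ⟨z₀, hz₀, hmax⟩ := hK.exists_isMaxOn hne continuous_norm.continuousOn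
    -- With z₀ of maximal modulus in K, ‖z₀‖ / 16 bounds every modulus ‖a k * z‖, so one linear
    -- estimate of P - 1 near 0 serves for all factors.
    have hr : Summable (seriesTerm P ((‖z₀‖ / 16 : ℝ) : ℂ)) := by
      refine hP _ ((enorm_le_iff_norm_le.2 ?_).trans_lt (div_four_pow_mem (hKU hz₀) 0))
      simp [div_eq_inv_mul]; norm_num
    obtain ⟨C, hC, hbound⟩ := exists_norm_seriesSum_sub_one_le (F := P)
      (constantCoeff_expTrace t) (by positivity) hr
    have hak (k : ℕ) : ‖a k‖ = (4 : ℝ)⁻¹ ^ k / 16 := by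
      simp [ha, pow_add]; ring
    have hle {z : ℂ} (hz : z ∈ K) (k : ℕ) : ‖a k * z‖ ≤ (4 : ℝ)⁻¹ ^ k * (‖z₀‖ / 16) := by
      rw [norm_mul, hak]
      have : ‖z‖ ≤ ‖z₀‖ := hmax hz
      calc (4 : ℝ)⁻¹ ^ k / 16 * ‖z‖ ≤ (4 : ℝ)⁻¹ ^ k / 16 * ‖z₀‖ := by gcongr
        _ = _ := by ring
    -- The multiplicities grow polynomially in k while the distance of P (a k * z) from 1 decays
    -- like 4^(-k).
    have hsum : Summable fun k : ℕ ↦ ((k + 3).choose 3 : ℝ) *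
        (C * ((4 : ℝ)⁻¹ ^ k * (‖z₀‖ / 16))) := by
      have := (summable_choose_mul_geometric_of_norm_lt_one (R := ℝ) 3 (r := (4 : ℝ)⁻¹)
        (by norm_num)).mul_right (C * (‖z₀‖ / 16))
      refine this.congr fun k ↦ by ring
    have := Summable.hasProdUniformlyOn_nat_one_add (f := fun k z ↦ seriesSum (E k) z - 1) hK
      (summable_exp_sub_one hsum fun k ↦ by positivity) (Eventually.of_forall fun k z hz ↦ ?_)
      fun k ↦ ((hcont k).mono hKU).sub continuousOn_const
    · simpa using this
    · rw [(hEs k (hKU hz)).2]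
      have h1 := norm_one_add_pow_sub_one_le (seriesSum P (a k * z) - 1) ((k + 3).choose 3)
      rw [add_sub_cancel] at h1
      refine h1.trans ?_
      gcongr
      refine (hbound _ ((hle hz k).trans ?_)).trans (by gcongr; exact hle hz k)
      exact mul_le_of_le_one_left (by positivity) (pow_le_one₀ (by norm_num) (by norm_num))
  -- identification of the limit
  have hN (N : ℕ) {z : ℂ} (hz : ‖z‖ₑ < 16 * R) := seriesTerm_prod (Finset.range N) E
    fun i _ ↦ (hEs i hz).1
  have hlim : TendstoLocallyUniformlyOn (fun N ↦ seriesSum (∏ k ∈ Finset.range N, E k))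
      (fun z ↦ ∏' k, seriesSum (E k) z) atTop U := by
    refine hprod.tendstoLocallyUniformlyOn_finsetRange.congr fun N z hz ↦ ?_
    exact ((hN N hz).2).symm
  have hcoeff (n : ℕ) : Tendsto (fun N ↦ PowerSeries.coeff n (∏ k ∈ Finset.range N, E k)) atTop
      (𝓝 (PowerSeries.coeff n (expTrace f))) := by
    have hEk (k : ℕ) : E k = expTrace ((k + 3).choose 3 • fun n ↦ a k ^ n * t n) := by
      rw [expTrace_nsmul, ← rescale_expTrace]
    simp only [hEk, ← expTrace_sum]
    refine tendsto_coeff_expTrace (fun n hn ↦ ?_) n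
    simpa [ha] using (hf n hn).tendsto_sum_nat
  have hfin {z : ℂ} (hz : ‖z‖ₑ < 16 * R) : HasSum (seriesTerm (expTrace f) z)
      (∏' k, seriesSum (E k) z) :=
    hasSum_seriesTerm_of_tendsto hR' (fun N z hz ↦ (hN N hz).1) hlim hcoeff hz
  refine ⟨fun z hz ↦ (hfin hz).summable, ?_⟩
  have h1 := hprod.congr_right fun z hz ↦ ((hfin hz).tsum_eq).symm
  refine TendstoLocallyUniformlyOn.congr h1 fun s z hz ↦ ?_
  simp only [mul_div_six_eq_choose]
  refine Finset.prod_congr rfl fun k _ ↦ ?_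
  rw [(hEs k hz).2, ha, div_eq_inv_mul]

/-- The denominator equals 4^(2n)(1 - 4^(-n))⁴, so this is the negative binomial series with
exponent 4 at 4^(-n). -/
theorem hasSum_inv_det (n : ℕ) (hn : n ≠ 0) (t : ℂ) :
    HasSum (fun k : ℕ ↦ ((k + 3).choose 3 : ℂ) * (((4 ^ (k + 2))⁻¹ : ℂ) ^ n * t))
      (t / (((4 ^ n - 1) ^ 2 * (1 - (4 ^ n)⁻¹) ^ 2 : ℝ) : ℂ)) := by
  have h4 : (1 : ℝ) < 4 ^ n := one_lt_pow₀ (by norm_num) hn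
  have hr : ‖(((4 : ℝ) ^ n)⁻¹ : ℝ)‖ < 1 := by
    rw [norm_inv, Real.norm_of_nonneg (by positivity)]; exact inv_lt_one_of_one_lt₀ h4
  have h1 := hasSum_choose_mul_geometric_of_norm_lt_one 3 hr
  have h2 := (Complex.hasSum_ofReal.2 h1).mul_right ((((4 : ℂ) ^ n)⁻¹) ^ 2 * t)
  have e : t / (((4 ^ n - 1) ^ 2 * (1 - (4 ^ n)⁻¹) ^ 2 : ℝ) : ℂ) =
      ((1 / (1 - (4 ^ n)⁻¹) ^ (3 + 1) : ℝ) : ℂ) * ((((4 : ℂ) ^ n)⁻¹) ^ 2 * t) := by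
    have h5 : (4 : ℂ) ^ n ≠ 0 := pow_ne_zero _ (by norm_num)
    have h6 : (4 : ℂ) ^ n - 1 ≠ 0 := by
      have : (((4 : ℝ) ^ n - 1 : ℝ) : ℂ) ≠ 0 := by
        rw [Complex.ofReal_ne_zero]; linarith
      simpa using this
    push_cast
    have h7 : 1 - ((4 : ℂ) ^ n)⁻¹ = (4 ^ n - 1) / 4 ^ n := by field_simp
    rw [h7]
    field_simp
  rw [e]
  refine HasSum.congr_fun h2 fun k ↦ ?_
  push_cast
  have : (((4 : ℂ) ^ (k + 2))⁻¹) ^ n = ((4 ^ n)⁻¹) ^ k * ((4 ^ n)⁻¹) ^ 2 := by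
    rw [← pow_add, inv_pow, inv_pow, pow_right_comm]
  rw [this]
  ring

theorem summable_mul_pow_of_lt_radius {α : ℕ → ℂ} {z : ℂ}
    (hz : ‖z‖ₑ < (FormalMultilinearSeries.ofScalars ℂ α).radius) :
    Summable fun n ↦ α n * z ^ n := by
  have := (FormalMultilinearSeries.ofScalars ℂ α).summable_norm_apply (x := z) (by simpa using hz)
  simpa [FormalMultilinearSeries.ofScalars_apply_eq, mul_comm] using this.of_norm

theorem hasSum_seriesTerm_C (a z : ℂ) : HasSum (seriesTerm (PowerSeries.C a) z) a := by
  have : seriesTerm (PowerSeries.C a) z = fun n ↦ if n = 0 then a else 0 := by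
    ext n; rw [seriesTerm, PowerSeries.coeff_C]; split_ifs with h <;> simp [h]
  rw [this]; exact hasSum_ite_eq 0 a

theorem hasSum_seriesTerm_X (z : ℂ) : HasSum (seriesTerm PowerSeries.X z) z := by
  have : seriesTerm PowerSeries.X z = fun n ↦ if n = 1 then z else 0 := by
    ext n; rw [seriesTerm, PowerSeries.coeff_X]; split_ifs with h <;> simp [h]
  rw [this]; exact hasSum_ite_eq 1 z

theorem HasSum.seriesTerm_mul {F G : PowerSeries ℂ} {z a b : ℂ} (hF : HasSum (seriesTerm F z) a)
    (hG : HasSum (seriesTerm G z) b) : HasSum (seriesTerm (F * G) z) (a * b) := by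
  have := (summable_seriesTerm_mul hF.summable hG.summable).hasSum
  have h2 := seriesSum_mul hF.summable hG.summable
  rw [seriesSum, seriesSum, seriesSum, hF.tsum_eq, hG.tsum_eq] at h2
  rwa [h2] at this

theorem HasSum.seriesTerm_sub {F G : PowerSeries ℂ} {z a b : ℂ} (hF : HasSum (seriesTerm F z) a)
    (hG : HasSum (seriesTerm G z) b) : HasSum (seriesTerm (F - G) z) (a - b) := by
  refine HasSum.congr_fun (hF.sub hG) fun n ↦ ?_
  simp [seriesTerm, sub_mul]

theorem hasSum_seriesTerm_zetaInverse {α : ℕ → ℂ} {z s : ℂ}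
    (h : HasSum (fun n ↦ α n * z ^ n) s) :
    HasSum (seriesTerm (zetaInverse α) z) (1 - 2 * z - z * (1 - z) * s) := by
  have h1 := hasSum_seriesTerm_one z
  have hX := hasSum_seriesTerm_X z
  have hα : HasSum (seriesTerm (PowerSeries.mk α) z) s :=
    HasSum.congr_fun h fun n ↦ by simp [seriesTerm]
  have h2 : HasSum (seriesTerm 2 z) 2 := by
    have : (2 : PowerSeries ℂ) = PowerSeries.C 2 := (map_ofNat PowerSeries.C 2).symm
    rw [this]; exact hasSum_seriesTerm_C 2 z
  rw [zetaInverse]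
  exact (h1.seriesTerm_sub (h2.seriesTerm_mul hX)).seriesTerm_sub
    ((hX.seriesTerm_mul (h1.seriesTerm_sub hX)).seriesTerm_mul hα)

/-! ### The weight as a function of one real variable. -/

/-- A smooth bump function on the line, equal to `1` on `[3/4, 1]` and to `0` outside
`[1/2, 5/4]`. -/
noncomputable def lineBump : ContDiffBump (7 / 8 : ℝ) where
  rIn := 1 / 8
  rOut := 3 / 8
  rIn_pos := by norm_num
  rIn_lt_rOut := by norm_num

theorem lineBump_eq_one {x : ℝ} (h1 : 3 / 4 ≤ x) (h2 : x ≤ 1) : lineBump x = 1 := by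
  apply lineBump.one_of_mem_closedBall
  rw [Metric.mem_closedBall, Real.dist_eq, abs_le]
  simp only [lineBump]
  constructor <;> linarith

theorem lineBump_eq_zero {x : ℝ} (h : x ≤ 1 / 2 ∨ 5 / 4 ≤ x) : lineBump x = 0 := by
  apply lineBump.zero_of_le_dist
  rw [Real.dist_eq, le_abs]
  simp only [lineBump]
  rcases h with h | h
  · right; linarith
  · left; linarith

/-- The function on the line which is `α k` at the points `3/4 + 4 ^ (-k - 1) y`, `y ∈ [3/4, 1]`,
interpolated by rescaled bump functions. -/
noncomputable def bumpSeries (α : ℕ → ℂ) (u : ℝ) : ℂ :=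
  ∑' k, α k • (lineBump (4 ^ (k + 1) * (u - 3 / 4)) : ℂ)

theorem bumpSeries_of_le (α : ℕ → ℂ) {u : ℝ} (hu : u ≤ 3 / 4) : bumpSeries α u = 0 := by
  rw [bumpSeries]
  convert tsum_zero with k
  rw [lineBump_eq_zero]
  · simp
  · left
    have : (4 : ℝ) ^ (k + 1) * (u - 3 / 4) ≤ 0 :=
      mul_nonpos_of_nonneg_of_nonpos (by positivity) (by linarith)
    linarith

/-- Changing the index rescales the argument by at least 4 or at most 1/4, which takes [3/4, 1] into
the region where the bump vanishes: at most 1/4 for smaller indices, at least 3 for larger ones. -/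
theorem bumpSeries_of_mem (α : ℕ → ℂ) {u : ℝ} (k : ℕ) (h1 : 3 / 4 ≤ 4 ^ (k + 1) * (u - 3 / 4))
    (h2 : 4 ^ (k + 1) * (u - 3 / 4) ≤ 1) : bumpSeries α u = α k := by
  rw [bumpSeries, tsum_eq_single k]
  · rw [lineBump_eq_one h1 h2]; simp
  · intro j hj
    rw [lineBump_eq_zero]
    · simp
    rcases lt_or_gt_of_ne hj with h | h
    · left
      obtain ⟨i, rfl⟩ := Nat.exists_eq_add_of_lt h
      have e : (4 : ℝ) ^ (j + i + 1 + 1) * (u - 3 / 4) =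
          4 ^ i * 4 * (4 ^ (j + 1) * (u - 3 / 4)) := by ring
      rw [e] at h1 h2
      have h4 : (1 : ℝ) ≤ 4 ^ i := one_le_pow₀ (by norm_num)
      have hp : 0 < 4 ^ (j + 1) * (u - 3 / 4) := by
        by_contra hc
        have := mul_nonpos_of_nonneg_of_nonpos (by positivity : (0 : ℝ) ≤ 4 ^ i * 4) (not_lt.1 hc)
        linarith
      nlinarith
    · right
      obtain ⟨i, rfl⟩ := Nat.exists_eq_add_of_lt h
      have e : (4 : ℝ) ^ (k + i + 1 + 1) * (u - 3 / 4) =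
          4 ^ i * 4 * (4 ^ (k + 1) * (u - 3 / 4)) := by ring
      rw [e]
      have h4 : (1 : ℝ) ≤ 4 ^ i := one_le_pow₀ (by norm_num)
      nlinarith

/-- Each derivative of the k-th bump costs a factor 4^(k+1), so orders up to r are dominated by the
assumed series. -/
theorem contDiff_bumpSeries {α : ℕ → ℂ} {r : ℕ} (h : Summable fun k ↦ ‖α k‖ * ((4 : ℝ) ^ r) ^ k) :
    ContDiff ℝ r (bumpSeries α) := by
  set F : ℝ → ℂ := fun x ↦ (lineBump x : ℂ) with hF
  have hFs : ContDiff ℝ ∞ F := Complex.ofRealCLM.contDiff.comp lineBump.contDiff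
  have hFc : HasCompactSupport F := lineBump.hasCompactSupport.comp_left (g := Complex.ofReal) rfl
  have hb (n : ℕ) : ∃ C, ∀ x, ‖iteratedDeriv n F x‖ ≤ C := by
    have h1 : Continuous (iteratedDeriv n F) :=
      hFs.continuous_iteratedDeriv n (by exact_mod_cast le_top)
    refine HasCompactSupport.exists_bound_of_continuous ?_ h1
    have := hFc.iteratedFDeriv (𝕜 := ℝ) n
    rw [HasCompactSupport, tsupport] at this ⊢
    convert this using 2
    ext x
    rw [Function.mem_support, Function.mem_support, ← norm_ne_zero_iff,
      ← norm_iteratedFDeriv_eq_norm_iteratedDeriv (𝕜 := ℝ), norm_ne_zero_iff]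
  choose C hC using hb
  have hC0 (n : ℕ) : 0 ≤ C n := (norm_nonneg _).trans (hC n 0)
  have hs (k : ℕ) (c : ℝ) : ContDiff ℝ ∞ fun x ↦ α k • F (c * (x - 3 / 4)) :=
    (hFs.comp (contDiff_const.mul (contDiff_id.sub contDiff_const))).const_smul (α k)
  refine contDiff_tsum (𝕜 := ℝ) (N := r)
    (f := fun k u ↦ α k • (lineBump (4 ^ (k + 1) * (u - 3 / 4)) : ℂ))
    (v := fun n k ↦ C n * 4 ^ r * (‖α k‖ * ((4 : ℝ) ^ r) ^ k)) (fun k ↦ ?_) (fun n _ ↦ ?_)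
    fun n k x hn ↦ ?_
  · exact (hs k (4 ^ (k + 1))).of_le (by exact_mod_cast le_top)
  · exact h.mul_left _
  · have hn' : n ≤ r := by exact_mod_cast hn
    have e1 : iteratedDeriv n (fun u ↦ F (4 ^ (k + 1) * (u - 3 / 4))) x =
        ((4 : ℝ) ^ (k + 1)) ^ n • iteratedDeriv n F (4 ^ (k + 1) * (x - 3 / 4)) := by
      have h1 := iteratedDeriv_comp_sub_const n (fun u ↦ F ((4 : ℝ) ^ (k + 1) * u)) (3 / 4 : ℝ)
      have h2 := iteratedDeriv_comp_const_smul (n := n) (f := F)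
        (hFs.of_le (by exact_mod_cast le_top)) ((4 : ℝ) ^ (k + 1))
      rw [h1, h2]
    have e2 : iteratedDeriv n (fun u ↦ α k • F (4 ^ (k + 1) * (u - 3 / 4))) x =
        α k • iteratedDeriv n (fun u ↦ F (4 ^ (k + 1) * (u - 3 / 4))) x := by
      exact iteratedDeriv_const_smul_field (α k) fun u ↦ F (4 ^ (k + 1) * (u - 3 / 4))
    rw [norm_iteratedFDeriv_eq_norm_iteratedDeriv, e2, e1, norm_smul, norm_smul, norm_pow, norm_pow,
      Real.norm_of_nonneg (by norm_num)]
    calc ‖α k‖ * (((4 : ℝ) ^ (k + 1)) ^ n * ‖iteratedDeriv n F (4 ^ (k + 1) * (x - 3 / 4))‖)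
        ≤ ‖α k‖ * (((4 : ℝ) ^ (k + 1)) ^ r * C n) := by
          gcongr
          · exact one_le_pow₀ (by norm_num)
          · exact hC n _
      _ = _ := by rw [pow_right_comm, pow_succ]; ring

/-! ### Diffeomorphisms of the sphere from homogeneous maps of ℝ⁵. -/

theorem contMDiff_coe_S4 : ContMDiff (𝓡 4) 𝓘(ℝ, EuclideanSpace ℝ (Fin 5)) ∞
    ((↑) : S4 → EuclideanSpace ℝ (Fin 5)) := by
  have : Fact (Module.finrank ℝ (EuclideanSpace ℝ (Fin 5)) = 4 + 1) := ⟨by simp⟩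
  exact contMDiff_coe_sphere

theorem ContMDiff.mk_S4 {d : ℕ} {M : Type*} [TopologicalSpace M]
    [ChartedSpace (EuclideanSpace ℝ (Fin d)) M] [IsManifold (𝓡 d) ∞ M]
    {f : M → EuclideanSpace ℝ (Fin 5)}
    (hf : ContMDiff (𝓡 d) 𝓘(ℝ, EuclideanSpace ℝ (Fin 5)) ∞ f)
    (h : ∀ x, f x ∈ Metric.sphere (0 : EuclideanSpace ℝ (Fin 5)) 1) :
    ContMDiff (𝓡 d) (𝓡 4) ∞ fun x ↦ (⟨f x, h x⟩ : S4) := by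
  have : Fact (Module.finrank ℝ (EuclideanSpace ℝ (Fin 5)) = 4 + 1) := ⟨by simp⟩
  exact hf.codRestrict_sphere h

/-- A positively homogeneous bijection of `ℝ⁵`, smooth with a smooth inverse outside the origin. -/
structure ConicDiffeo where
  toFun : EuclideanSpace ℝ (Fin 5) → EuclideanSpace ℝ (Fin 5)
  invFun : EuclideanSpace ℝ (Fin 5) → EuclideanSpace ℝ (Fin 5)
  left_inv (x) : invFun (toFun x) = x
  right_inv (x) : toFun (invFun x) = x
  map_smul (c : ℝ) (hc : 0 < c) (x) : toFun (c • x) = c • toFun x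
  inv_smul (c : ℝ) (hc : 0 < c) (x) : invFun (c • x) = c • invFun x
  map_zero : toFun 0 = 0
  contDiffOn : ContDiffOn ℝ ∞ toFun {0}ᶜ
  contDiffOn_inv : ContDiffOn ℝ ∞ invFun {0}ᶜ

namespace ConicDiffeo

/-- The inverse of a conic diffeomorphism. -/
def symm (f : ConicDiffeo) : ConicDiffeo where
  toFun := f.invFun
  invFun := f.toFun
  left_inv := f.right_inv
  right_inv := f.left_inv
  map_smul := f.inv_smul
  inv_smul := f.map_smul
  map_zero := by rw [← f.map_zero, f.left_inv, f.map_zero]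
  contDiffOn := f.contDiffOn_inv
  contDiffOn_inv := f.contDiffOn

theorem map_ne_zero (f : ConicDiffeo) {x : EuclideanSpace ℝ (Fin 5)} (hx : x ≠ 0) :
    f.toFun x ≠ 0 := by
  intro h
  have := f.left_inv x
  rw [h] at this
  exact hx (this ▸ f.symm.map_zero)

/-- The composition of two conic diffeomorphisms. -/
def comp (f g : ConicDiffeo) : ConicDiffeo where
  toFun := f.toFun ∘ g.toFun
  invFun := g.invFun ∘ f.invFun
  left_inv x := by simp [f.left_inv, g.left_inv]
  right_inv x := by simp [f.right_inv, g.right_inv]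
  map_smul c hc x := by simp [f.map_smul c hc, g.map_smul c hc]
  inv_smul c hc x := by simp [f.inv_smul c hc, g.inv_smul c hc]
  map_zero := by simp [f.map_zero, g.map_zero]
  contDiffOn := f.contDiffOn.comp g.contDiffOn fun _ hx ↦ g.map_ne_zero hx
  contDiffOn_inv := g.contDiffOn_inv.comp f.contDiffOn_inv fun _ hx ↦ f.symm.map_ne_zero hx

/-- The action of a conic diffeomorphism on the sphere. -/
noncomputable def sphereMap (f : ConicDiffeo) (x : S4) : S4 :=
  ⟨‖f.toFun x‖⁻¹ • f.toFun x, by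
    have : f.toFun x ≠ 0 := f.map_ne_zero (ne_zero_of_mem_unit_sphere x)
    simp [norm_smul, this]⟩

theorem sphereMap_eq (f : ConicDiffeo) (x : S4) {y : EuclideanSpace ℝ (Fin 5)}
    (h : ∃ c : ℝ, 0 < c ∧ (x : EuclideanSpace ℝ (Fin 5)) = c • y) :
    (f.sphereMap x : EuclideanSpace ℝ (Fin 5)) = ‖f.toFun y‖⁻¹ • f.toFun y := by
  obtain ⟨c, hc, hx⟩ := h
  change ‖f.toFun x‖⁻¹ • f.toFun x = _
  rw [hx]
  simp only [f.map_smul c hc, norm_smul, Real.norm_of_nonneg hc.le, mul_inv, smul_smul]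
  congr 1
  field_simp

theorem symm_sphereMap (f : ConicDiffeo) (x : S4) : f.symm.sphereMap (f.sphereMap x) = x := by
  apply Subtype.ext
  rw [sphereMap_eq f.symm (f.sphereMap x) (y := f.toFun x)]
  · simp only [symm, f.left_inv]; simp
  · have : f.toFun x ≠ 0 := f.map_ne_zero (ne_zero_of_mem_unit_sphere x)
    exact ⟨‖f.toFun x‖⁻¹, by positivity, rfl⟩

theorem contMDiff_sphereMap (f : ConicDiffeo) : ContMDiff (𝓡 4) (𝓡 4) ∞ f.sphereMap := by
  apply ContMDiff.mk_S4
  have h1 : ContDiffOn ℝ ∞ (fun x ↦ ‖f.toFun x‖⁻¹ • f.toFun x) {0}ᶜ := by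
    have h2 : ContDiffOn ℝ ∞ (fun x ↦ ‖f.toFun x‖) {0}ᶜ :=
      f.contDiffOn.norm ℝ fun x hx ↦ f.map_ne_zero hx
    exact (h2.inv fun x hx ↦ norm_ne_zero_iff.2 (f.map_ne_zero hx)).smul f.contDiffOn
  exact h1.contMDiffOn.comp_contMDiff contMDiff_coe_S4 fun x ↦ ne_zero_of_mem_unit_sphere x

/-- A conic diffeomorphism induces a diffeomorphism of the sphere. -/
noncomputable def toDiffeomorph (f : ConicDiffeo) : S4 ≃ₘ⟮𝓡 4, 𝓡 4⟯ S4 where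
  toFun := f.sphereMap
  invFun := f.symm.sphereMap
  left_inv := f.symm_sphereMap
  right_inv := f.symm.symm_sphereMap
  contMDiff_toFun := f.contMDiff_sphereMap
  contMDiff_invFun := f.symm.contMDiff_sphereMap

end ConicDiffeo

/-- The diagonal map with entries `4, 4, 1/4, 1/4, 1`. -/
noncomputable def conicDiag : ConicDiffeo where
  toFun x := !₂[4 * x 0, 4 * x 1, x 2 / 4, x 3 / 4, x 4]
  invFun x := !₂[x 0 / 4, x 1 / 4, 4 * x 2, 4 * x 3, x 4]
  left_inv x := by ext i; fin_cases i <;> simp <;> ring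
  right_inv x := by ext i; fin_cases i <;> simp <;> ring
  map_smul c _ x := by ext i; fin_cases i <;> simp <;> ring
  inv_smul c _ x := by ext i; fin_cases i <;> simp <;> ring
  map_zero := by ext i; fin_cases i <;> simp
  contDiffOn := by
    refine contDiffOn_euclidean.2 fun i ↦ ?_
    fin_cases i <;> simp <;> fun_prop
  contDiffOn_inv := by
    refine contDiffOn_euclidean.2 fun i ↦ ?_
    fin_cases i <;> simp <;> fun_prop

/-- The squared cosine of the angle between `(x₀ - a x₄, x₁, x₂ - b x₄, x₃, x₄)` and the last
coordinate axis. -/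
noncomputable def axisRatio (a b : ℝ) (x : EuclideanSpace ℝ (Fin 5)) : ℝ :=
  x 4 ^ 2 / ((x 0 - a * x 4) ^ 2 + x 1 ^ 2 + (x 2 - b * x 4) ^ 2 + x 3 ^ 2 + x 4 ^ 2)

/-- The rotation of the coordinates `x₀, x₂` around the centre `(a x₄, b x₄)`, by the angle
`θ (axisRatio a b x)`. -/
noncomputable def twistMap (a b : ℝ) (θ : ℝ → ℝ) (x : EuclideanSpace ℝ (Fin 5)) :
    EuclideanSpace ℝ (Fin 5) :=
  !₂[a * x 4 + (Real.cos (θ (axisRatio a b x)) * (x 0 - a * x 4) -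
        Real.sin (θ (axisRatio a b x)) * (x 2 - b * x 4)), x 1,
    b * x 4 + (Real.sin (θ (axisRatio a b x)) * (x 0 - a * x 4) +
        Real.cos (θ (axisRatio a b x)) * (x 2 - b * x 4)), x 3, x 4]

/-- A rotation around the centre keeps the distance to it. The angle is therefore the same at a
point and at its image, which makes the twist by the opposite angle the inverse. -/
theorem axisRatio_twistMap (a b : ℝ) (θ : ℝ → ℝ) (x : EuclideanSpace ℝ (Fin 5)) :
    axisRatio a b (twistMap a b θ x) = axisRatio a b x := by
  have h := Real.sin_sq_add_cos_sq (θ (axisRatio a b x))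
  simp only [axisRatio, twistMap] at h ⊢
  simp
  congr 1
  linear_combination ((x 0 - a * x 4) ^ 2 + (x 2 - b * x 4) ^ 2) * h

theorem twistMap_twistMap (a b : ℝ) (θ θ' : ℝ → ℝ) (h : ∀ q, θ' q = -θ q)
    (x : EuclideanSpace ℝ (Fin 5)) : twistMap a b θ' (twistMap a b θ x) = x := by
  have hq := axisRatio_twistMap a b θ x
  have e := Real.sin_sq_add_cos_sq (θ (axisRatio a b x))
  rw [twistMap, hq, h, Real.cos_neg, Real.sin_neg]
  set q := axisRatio a b x
  simp only [twistMap]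
  ext i
  fin_cases i
  · simp; linear_combination (x 0 - a * x 4) * e
  · simp
  · simp; linear_combination (x 2 - b * x 4) * e
  · simp
  · simp

theorem twistMap_smul (a b : ℝ) (θ : ℝ → ℝ) (c : ℝ) (hc : 0 < c) (x : EuclideanSpace ℝ (Fin 5)) :
    twistMap a b θ (c • x) = c • twistMap a b θ x := by
  have hq : axisRatio a b (c • x) = axisRatio a b x := by
    simp only [axisRatio, PiLp.smul_apply, smul_eq_mul]
    have h1 : (c * x 0 - a * (c * x 4)) ^ 2 + (c * x 1) ^ 2 + (c * x 2 - b * (c * x 4)) ^ 2 +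
        (c * x 3) ^ 2 + (c * x 4) ^ 2 = c ^ 2 * ((x 0 - a * x 4) ^ 2 + x 1 ^ 2 +
          (x 2 - b * x 4) ^ 2 + x 3 ^ 2 + x 4 ^ 2) := by ring
    rw [h1, mul_pow, mul_div_mul_left _ _ (by positivity)]
  simp only [twistMap, hq]
  ext i
  fin_cases i <;> simp <;> ring

theorem contDiffOn_twistMap (a b : ℝ) {θ : ℝ → ℝ} (hθ : ContDiff ℝ ∞ θ) :
    ContDiffOn ℝ ∞ (twistMap a b θ) {0}ᶜ := by
  -- Unlike the distance in the chart, this ratio is smooth across the equator `x 4 = 0`, since its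
  -- denominator vanishes only at the origin.
  have hq : ContDiffOn ℝ ∞ (axisRatio a b) {0}ᶜ := by
    refine ContDiffOn.div (by fun_prop) (by fun_prop) fun x hx h ↦ hx ?_
    have h4 : x 4 = 0 := by
      nlinarith [sq_nonneg (x 0 - a * x 4), sq_nonneg (x 1), sq_nonneg (x 3),
      sq_nonneg (x 2 - b * x 4), sq_nonneg (x 4)]
    simp only [h4, mul_zero, sub_zero] at h
    ext i
    fin_cases i
    all_goals
      simp
      nlinarith [sq_nonneg (x 0), sq_nonneg (x 1), sq_nonneg (x 3), sq_nonneg (x 2),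
        sq_nonneg (x 4)]
  have hθq := hθ.comp_contDiffOn hq
  have hs := Real.contDiff_sin.comp_contDiffOn hθq
  have hc := Real.contDiff_cos.comp_contDiffOn hθq
  have h0 (i : Fin 5) : ContDiffOn ℝ ∞ (fun x : EuclideanSpace ℝ (Fin 5) ↦ x i) {0}ᶜ := by fun_prop
  have ha : ContDiffOn ℝ ∞ (fun x : EuclideanSpace ℝ (Fin 5) ↦ x 0 - a * x 4) {0}ᶜ := by fun_prop
  have hb : ContDiffOn ℝ ∞ (fun x : EuclideanSpace ℝ (Fin 5) ↦ x 2 - b * x 4) {0}ᶜ := by fun_prop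
  refine contDiffOn_euclidean.2 fun i ↦ ?_
  fin_cases i
  · exact (contDiffOn_const.mul (h0 4)).add ((hc.mul ha).sub (hs.mul hb))
  · exact h0 1
  · exact (contDiffOn_const.mul (h0 4)).add ((hs.mul ha).add (hc.mul hb))
  · exact h0 3
  · exact h0 4

/-- The rotation of the coordinates `x₀, x₂` with variable angle, as a conic diffeomorphism. -/
noncomputable def conicTwist (a b : ℝ) (θ : ℝ → ℝ) (hθ : ContDiff ℝ ∞ θ) : ConicDiffeo where
  toFun := twistMap a b θ
  invFun := twistMap a b (-θ)
  left_inv := twistMap_twistMap a b θ (-θ) fun _ ↦ rfl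
  right_inv := twistMap_twistMap a b (-θ) θ fun _ ↦ by simp
  map_smul := twistMap_smul a b θ
  inv_smul := twistMap_smul a b (-θ)
  map_zero := by ext i; fin_cases i <;> simp [twistMap]
  contDiffOn := contDiffOn_twistMap a b hθ
  contDiffOn_inv := contDiffOn_twistMap a b hθ.neg

/-! ### The gnomonic chart. -/

/-- The point `(y, 1)` of `ℝ⁵`. -/
noncomputable def liftOne (y : EuclideanSpace ℝ (Fin 4)) : EuclideanSpace ℝ (Fin 5) :=
  !₂[y 0, y 1, y 2, y 3, 1]

theorem norm_sq_four (y : EuclideanSpace ℝ (Fin 4)) :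
    ‖y‖ ^ 2 = y 0 ^ 2 + y 1 ^ 2 + y 2 ^ 2 + y 3 ^ 2 := by
  simp [EuclideanSpace.norm_sq_eq, Fin.sum_univ_four]

theorem norm_sq_five (x : EuclideanSpace ℝ (Fin 5)) :
    ‖x‖ ^ 2 = x 0 ^ 2 + x 1 ^ 2 + x 2 ^ 2 + x 3 ^ 2 + x 4 ^ 2 := by
  simp [EuclideanSpace.norm_sq_eq, Fin.sum_univ_five]

theorem norm_liftOne_sq (y : EuclideanSpace ℝ (Fin 4)) : ‖liftOne y‖ ^ 2 = ‖y‖ ^ 2 + 1 := by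
  rw [norm_sq_five, norm_sq_four]; simp [liftOne]

theorem liftOne_ne_zero (y : EuclideanSpace ℝ (Fin 4)) : liftOne y ≠ 0 := by
  intro h
  have := norm_liftOne_sq y
  rw [h, norm_zero] at this
  nlinarith [sq_nonneg ‖y‖]

/-- The gnomonic parametrization of the upper hemisphere. -/
noncomputable def gnomonic (y : EuclideanSpace ℝ (Fin 4)) : S4 :=
  ⟨‖liftOne y‖⁻¹ • liftOne y, by simp [norm_smul, liftOne_ne_zero y]⟩

theorem contDiff_liftOne : ContDiff ℝ ∞ liftOne := by
  refine contDiff_euclidean.2 fun i ↦ ?_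
  fin_cases i <;> simp [liftOne] <;> fun_prop

theorem contMDiff_gnomonic : ContMDiff (𝓡 4) (𝓡 4) ∞ gnomonic := by
  apply ContMDiff.mk_S4
  rw [contMDiff_iff_contDiff]
  have h2 : ContDiff ℝ ∞ (fun y ↦ ‖liftOne y‖) := contDiff_liftOne.norm ℝ liftOne_ne_zero
  exact (h2.inv fun x ↦ norm_ne_zero_iff.2 (liftOne_ne_zero x)).smul contDiff_liftOne

theorem sphereMap_gnomonic (f : ConicDiffeo) {y z : EuclideanSpace ℝ (Fin 4)}
    (h : f.toFun (liftOne y) = liftOne z) : f.sphereMap (gnomonic y) = gnomonic z := by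
  apply Subtype.ext
  rw [f.sphereMap_eq (gnomonic y) (y := liftOne y), h]
  · rfl
  · exact ⟨‖liftOne y‖⁻¹, inv_pos.2 (norm_pos_iff.2 (liftOne_ne_zero y)), rfl⟩

/-- A smooth function on the line equal to `1 / t` if `t ^ 2 ≥ 1 / 25`. -/
noncomputable def smoothInv (t : ℝ) : ℝ := t / (t ^ 2 + Real.smoothTransition (1 - 25 * t ^ 2))

theorem smoothInv_eq {t : ℝ} (ht : 1 ≤ 25 * t ^ 2) : smoothInv t = t⁻¹ := by
  have h0 : t ≠ 0 := by rintro rfl; norm_num at ht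
  rw [smoothInv, Real.smoothTransition.zero_of_nonpos (by linarith)]
  field_simp
  simp

theorem contDiff_smoothInv : ContDiff ℝ ∞ smoothInv := by
  have h1 : ContDiff ℝ ∞ fun t : ℝ ↦ Real.smoothTransition (1 - 25 * t ^ 2) :=
    Real.smoothTransition.contDiff.comp (by fun_prop)
  refine contDiff_id.div (ContDiff.add (by fun_prop) h1) fun t ↦ ?_
  rcases eq_or_ne t 0 with rfl | h
  · simp
  · have := Real.smoothTransition.nonneg (1 - 25 * t ^ 2)
    have : 0 < t ^ 2 := by positivity
    linarith

/-- A smooth map from the sphere to `ℝ⁴` which inverts `gnomonic` on a ball. -/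
noncomputable def gnomonicInv (x : S4) : EuclideanSpace ℝ (Fin 4) :=
  !₂[(x : EuclideanSpace ℝ (Fin 5)) 0 * smoothInv ((x : EuclideanSpace ℝ (Fin 5)) 4),
    (x : EuclideanSpace ℝ (Fin 5)) 1 * smoothInv ((x : EuclideanSpace ℝ (Fin 5)) 4),
    (x : EuclideanSpace ℝ (Fin 5)) 2 * smoothInv ((x : EuclideanSpace ℝ (Fin 5)) 4),
    (x : EuclideanSpace ℝ (Fin 5)) 3 * smoothInv ((x : EuclideanSpace ℝ (Fin 5)) 4)]

theorem contMDiff_gnomonicInv :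
    ContMDiff (𝓡 4) 𝓘(ℝ, EuclideanSpace ℝ (Fin 4)) ∞ gnomonicInv := by
  have h : ContDiff ℝ ∞ fun x : EuclideanSpace ℝ (Fin 5) ↦
      (!₂[x 0 * smoothInv (x 4), x 1 * smoothInv (x 4), x 2 * smoothInv (x 4),
        x 3 * smoothInv (x 4)] : EuclideanSpace ℝ (Fin 4)) := by
    have h0 (i : Fin 5) : ContDiff ℝ ∞ fun x : EuclideanSpace ℝ (Fin 5) ↦ x i := by fun_prop
    have h1 := contDiff_smoothInv.comp (h0 4)
    refine contDiff_euclidean.2 fun i ↦ ?_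
    fin_cases i
    · exact (h0 0).mul h1
    · exact (h0 1).mul h1
    · exact (h0 2).mul h1
    · exact (h0 3).mul h1
  exact h.contMDiff.comp contMDiff_coe_S4

theorem gnomonic_apply_four (y : EuclideanSpace ℝ (Fin 4)) :
    (gnomonic y : EuclideanSpace ℝ (Fin 5)) 4 = ‖liftOne y‖⁻¹ := by
  simp [gnomonic, liftOne]

/-- Since ‖(y, 1)‖² = ‖y‖² + 1 ≤ 25, the last coordinate is at least 1/5, where `smoothInv` is the
true inverse. -/
theorem gnomonicInv_gnomonic {y : EuclideanSpace ℝ (Fin 4)} (hy : ‖y‖ ^ 2 ≤ 24) :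
    gnomonicInv (gnomonic y) = y := by
  have h1 : 0 < ‖liftOne y‖ := norm_pos_iff.2 (liftOne_ne_zero y)
  have h2 : smoothInv ((gnomonic y : EuclideanSpace ℝ (Fin 5)) 4) = ‖liftOne y‖ := by
    rw [gnomonic_apply_four, smoothInv_eq, inv_inv]
    rw [inv_pow, norm_liftOne_sq, ← div_eq_mul_inv, le_div_iff₀ (by positivity)]
    linarith
  have h3 (i : Fin 5) : (gnomonic y : EuclideanSpace ℝ (Fin 5)) i * ‖liftOne y‖ = liftOne y i := by
    simp only [gnomonic, PiLp.smul_apply, smul_eq_mul]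
    field_simp
  simp only [gnomonicInv, h2, h3]
  ext i
  fin_cases i <;> simp [liftOne]

/-- The part `x₄ > 1/5` of the sphere, where `gnomonicInv` inverts `gnomonic`. -/
def upperCap : Set S4 := {x | 1 / 5 < (x : EuclideanSpace ℝ (Fin 5)) 4}

theorem isOpen_upperCap : IsOpen upperCap := by
  refine isOpen_lt continuous_const ?_
  fun_prop

theorem gnomonic_mem_upperCap {y : EuclideanSpace ℝ (Fin 4)} (hy : ‖y‖ ^ 2 < 24) :
    gnomonic y ∈ upperCap := by
  change 1 / 5 < (gnomonic y : EuclideanSpace ℝ (Fin 5)) 4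
  rw [gnomonic_apply_four, one_div]
  have h1 : 0 < ‖liftOne y‖ := norm_pos_iff.2 (liftOne_ne_zero y)
  refine inv_strictAnti₀ h1 ?_
  have := norm_liftOne_sq y
  nlinarith

theorem gnomonic_gnomonicInv {x : S4} (hx : x ∈ upperCap) :
    gnomonic (gnomonicInv x) = x ∧ ‖gnomonicInv x‖ ^ 2 < 24 := by
  obtain ⟨x, hx1⟩ := x
  have hx5 : 1 / 5 < x 4 := hx
  have h0 : 0 < x 4 := by linarith
  have hnorm : ‖x‖ = 1 := by simpa using hx1
  have e : liftOne (gnomonicInv ⟨x, hx1⟩) = (x 4)⁻¹ • x := by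
    have h2 : smoothInv (x 4) = (x 4)⁻¹ := smoothInv_eq (by nlinarith)
    simp only [gnomonicInv, h2]
    ext i
    fin_cases i
    all_goals simp [liftOne, mul_comm]
    exact (mul_inv_cancel₀ h0.ne').symm
  have hn : ‖liftOne (gnomonicInv ⟨x, hx1⟩)‖ = (x 4)⁻¹ := by
    rw [e, norm_smul, hnorm, mul_one, Real.norm_of_nonneg (by positivity)]
  constructor
  · apply Subtype.ext
    change ‖liftOne (gnomonicInv ⟨x, hx1⟩)‖⁻¹ • liftOne (gnomonicInv ⟨x, hx1⟩) = x
    rw [hn, e, inv_inv, smul_smul, mul_inv_cancel₀ h0.ne', one_smul]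
  · have h3 := norm_liftOne_sq (gnomonicInv ⟨x, hx1⟩)
    rw [hn] at h3
    have h4 : (x 4)⁻¹ < 5 := by
      rw [inv_lt_comm₀ h0 (by norm_num)]; simpa using hx5
    have h5 : 0 < (x 4)⁻¹ := by positivity
    nlinarith

/-! ### The horseshoe map and its two affine branches. -/

/-- The angle of the first twist: `π / 2` far from the centre, `0` near the centre. -/
noncomputable def outerAngle (q : ℝ) : ℝ := Real.pi / 2 * Real.smoothTransition (2 - 6 * q)

/-- The angle of the second twist: `0` far from the centre, `- π / 2` near the centre. -/
noncomputable def innerAngle (q : ℝ) : ℝ :=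
  -(Real.pi / 2 * (1 - Real.smoothTransition (2 - 6 * q)))

theorem contDiff_outerAngle : ContDiff ℝ ∞ outerAngle :=
  contDiff_const.mul (Real.smoothTransition.contDiff.comp (by fun_prop))

theorem contDiff_innerAngle : ContDiff ℝ ∞ innerAngle :=
  (contDiff_const.mul (contDiff_const.sub (Real.smoothTransition.contDiff.comp (by fun_prop)))).neg

theorem smoothTransition_near {D : ℝ} (h0 : 0 ≤ D) (h : D ≤ 2) :
    Real.smoothTransition (2 - 6 * (1 / (D + 1))) = 0 := by
  apply Real.smoothTransition.zero_of_nonpos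
  have : 1 / 3 ≤ 1 / (D + 1) := one_div_le_one_div_of_le (by linarith) (by linarith)
  linarith

theorem smoothTransition_far {D : ℝ} (h : 5 ≤ D) :
    Real.smoothTransition (2 - 6 * (1 / (D + 1))) = 1 := by
  apply Real.smoothTransition.one_of_one_le
  have : 1 / (D + 1) ≤ 1 / 6 := one_div_le_one_div_of_le (by linarith) (by linarith)
  linarith

/-- The diffeomorphism of the sphere with the horseshoe. -/
noncomputable def horseshoeConic : ConicDiffeo :=
  (conicTwist (1 / 2) (7 / 2) innerAngle contDiff_innerAngle).comp
    ((conicTwist (1 / 2) (1 / 2) outerAngle contDiff_outerAngle).comp conicDiag)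

/-- The affine branch of the horseshoe map with index `b`. -/
noncomputable def branch (b : Bool) (y : EuclideanSpace ℝ (Fin 4)) : EuclideanSpace ℝ (Fin 4) :=
  !₂[4 * y 0 - (if b then 3 else 0), 4 * y 1, y 2 / 4 + (if b then 3 else 0), y 3 / 4]

/-- The box on which the horseshoe map is the affine branch with index `b`. -/
def branchBox (b : Bool) : Set (EuclideanSpace ℝ (Fin 4)) :=
  {y | |y 0 - (if b then 7 / 8 else 1 / 8)| < 3 / 16 ∧ |y 1| < 1 / 16 ∧
    |y 2 - 2| < 33 / 16 ∧ |y 3| < 1 / 16}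

theorem axisRatio_liftOne (a b : ℝ) (y : EuclideanSpace ℝ (Fin 4)) :
    axisRatio a b (liftOne y) =
      1 / ((y 0 - a) ^ 2 + y 1 ^ 2 + (y 2 - b) ^ 2 + y 3 ^ 2 + 1) := by
  simp [axisRatio, liftOne]

theorem twistMap_liftOne (a b : ℝ) (θ : ℝ → ℝ) (y : EuclideanSpace ℝ (Fin 4)) (φ : ℝ)
    (h : θ (1 / ((y 0 - a) ^ 2 + y 1 ^ 2 + (y 2 - b) ^ 2 + y 3 ^ 2 + 1)) = φ) :
    twistMap a b θ (liftOne y) =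
      liftOne !₂[a + (Real.cos φ * (y 0 - a) - Real.sin φ * (y 2 - b)), y 1,
        b + (Real.sin φ * (y 0 - a) + Real.cos φ * (y 2 - b)), y 3] := by
  simp only [twistMap, axisRatio_liftOne, h]
  ext i
  fin_cases i <;> simp [liftOne]

/-- In the coordinates (y 0, y 2), the diagonal map sends the two boxes near (1/2, 1/2) and (7/2,
1/2). The first twist fixes the former piece and turns the latter by π/2 around (1/2, 1/2), to (1/2,
7/2); the second turns it back around its own centre. The net effect is the translation by (-3, 3).
Here "near" means squared distance at most 2 and "far" at least 5, the thresholds of the two angle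
functions. -/
theorem horseshoeConic_liftOne {b : Bool} {y : EuclideanSpace ℝ (Fin 4)} (hy : y ∈ branchBox b) :
    horseshoeConic.toFun (liftOne y) = liftOne (branch b y) := by
  obtain ⟨h0, h1, h2, h3⟩ := hy
  rw [abs_lt] at h0 h1 h2 h3
  have e0 : conicDiag.toFun (liftOne y) = liftOne !₂[4 * y 0, 4 * y 1, y 2 / 4, y 3 / 4] := by
    ext i; fin_cases i <;> simp [conicDiag, liftOne]
  change twistMap (1 / 2) (7 / 2) innerAngle (twistMap (1 / 2) (1 / 2) outerAngle
    (conicDiag.toFun (liftOne y))) = _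
  rw [e0]
  have q1 : (4 * y 1) ^ 2 ≤ 1 / 16 := by nlinarith
  have q3 : (y 3 / 4) ^ 2 ≤ 1 / 16 := by nlinarith
  have q2 : (y 2 / 4 - 1 / 2) ^ 2 ≤ (33 / 64) ^ 2 := by nlinarith
  cases b
  · simp only [Bool.false_eq_true, reduceIte] at h0
    rw [twistMap_liftOne _ _ _ _ 0]
    · rw [twistMap_liftOne _ _ _ _ 0]
      · congr 1
        ext i; fin_cases i <;> simp [branch]
      · simp only [innerAngle]
        simp only [Real.cos_zero, Real.sin_zero]
        rw [smoothTransition_far]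
        · simp
        · simp
          nlinarith [sq_nonneg (4 * y 0 - 1 / 2), sq_nonneg (4 * y 1), sq_nonneg (y 3 / 4)]
    · rw [outerAngle, smoothTransition_near]
      · simp
      · positivity
      · simp
        nlinarith
  · simp only [reduceIte] at h0
    rw [twistMap_liftOne _ _ _ _ (Real.pi / 2)]
    · rw [twistMap_liftOne _ _ _ _ (-(Real.pi / 2))]
      · congr 1
        ext i; fin_cases i <;> simp [branch] <;> ring
      · simp only [innerAngle]
        rw [smoothTransition_near]
        · simp
        · positivity
        · simp
          nlinarith
    · rw [outerAngle, smoothTransition_far]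
      · simp
      · simp
        nlinarith [sq_nonneg (4 * y 1), sq_nonneg (y 3 / 4), sq_nonneg (y 2 / 4 - 1 / 2)]

/-! ### Symbolic coding. -/

/-- The sum of the base `4` expansion with digits `3` (for `true`) and `0` (for `false`). -/
noncomputable def digitSum (a : ℕ → Bool) : ℝ :=
  ∑' j, (if a j then 3 else 0) * (1 / 4 : ℝ) ^ (j + 1)

theorem hasSum_three_mul_pow : HasSum (fun j : ℕ ↦ 3 * (1 / 4 : ℝ) ^ (j + 1)) 1 := by
  have := (hasSum_geometric_of_lt_one (r := (1 / 4 : ℝ)) (by norm_num) (by norm_num)).mul_left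
    (3 / 4)
  rw [show (3 / 4 : ℝ) * (1 - 1 / 4)⁻¹ = 1 by norm_num] at this
  exact HasSum.congr_fun this fun j ↦ by ring

theorem digit_le (a : ℕ → Bool) (j : ℕ) :
    (if a j then 3 else 0) * (1 / 4 : ℝ) ^ (j + 1) ≤ 3 * (1 / 4 : ℝ) ^ (j + 1) := by
  gcongr; split_ifs <;> norm_num

theorem digit_nonneg (a : ℕ → Bool) (j : ℕ) :
    0 ≤ (if a j then 3 else 0) * (1 / 4 : ℝ) ^ (j + 1) := by
  split_ifs <;> positivity

theorem summable_digit (a : ℕ → Bool) :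
    Summable fun j ↦ (if a j then 3 else 0) * (1 / 4 : ℝ) ^ (j + 1) :=
  Summable.of_nonneg_of_le (digit_nonneg a) (digit_le a) hasSum_three_mul_pow.summable

theorem digitSum_nonneg (a : ℕ → Bool) : 0 ≤ digitSum a := tsum_nonneg (digit_nonneg a)

theorem digitSum_le_one (a : ℕ → Bool) : digitSum a ≤ 1 :=
  (Summable.tsum_le_tsum (digit_le a) (summable_digit a) hasSum_three_mul_pow.summable).trans_eq
    hasSum_three_mul_pow.tsum_eq

theorem digitSum_eq (a : ℕ → Bool) :
    digitSum a = (if a 0 then 3 else 0) / 4 + digitSum (fun j ↦ a (j + 1)) / 4 := by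
  rw [digitSum, (summable_digit a).tsum_eq_zero_add, digitSum, ← tsum_div_const]
  congr 1
  · rw [zero_add, pow_one]; ring
  · congr 1
    ext j
    ring

theorem continuous_digitSum : Continuous digitSum := by
  refine continuous_tsum (fun j ↦ ?_) hasSum_three_mul_pow.summable fun j a ↦ ?_
  · have h : Continuous fun b : Bool ↦ (if b then 3 else 0) * (1 / 4 : ℝ) ^ (j + 1) :=
      continuous_of_discreteTopology
    exact h.comp (continuous_apply j)
  · rw [Real.norm_of_nonneg (digit_nonneg a j)]
    exact digit_le a j

/-- The shift by `n` on bi-infinite sequences. -/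
def shiftBy (n : ℤ) (s : ℤ → Bool) : ℤ → Bool := fun i ↦ s (i + n)

theorem shiftBy_shiftBy (m n : ℤ) (s : ℤ → Bool) : shiftBy m (shiftBy n s) = shiftBy (m + n) s := by
  ext i; simp [shiftBy, add_assoc]

theorem shiftBy_zero (s : ℤ → Bool) : shiftBy 0 s = s := by
  ext i; simp [shiftBy]

/-- The point of the Cantor set in `ℝ⁴` with a given itinerary. -/
noncomputable def codePoint (s : ℤ → Bool) : EuclideanSpace ℝ (Fin 4) :=
  !₂[digitSum fun j ↦ s j, 0, 4 * digitSum fun j ↦ s (-1 - j), 0]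

theorem codePoint_mem_branchBox (s : ℤ → Bool) : codePoint s ∈ branchBox (s 0) := by
  have h1 := digitSum_eq fun j ↦ s j
  have h2 := digitSum_nonneg fun j ↦ s ((j + 1 : ℕ) : ℤ)
  have h3 := digitSum_le_one fun j ↦ s ((j + 1 : ℕ) : ℤ)
  have h4 := digitSum_nonneg fun j ↦ s (-1 - j)
  have h5 := digitSum_le_one fun j ↦ s (-1 - j)
  simp only [branchBox, codePoint, Set.mem_ofPred_eq, abs_lt]
  simp only [Nat.cast_zero] at h1
  refine ⟨?_, ?_, ?_, ?_⟩
  · cases h : s 0 <;> simp [h] at h1 ⊢ <;> constructor <;> push_cast at h2 h3 <;> linarith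
  · simp
  · simp; constructor <;> linarith
  · simp

/-- The expanding coordinate loses its first base 4 digit, while the contracting one gains it in
front: the shift in both directions of time. -/
theorem branch_codePoint (s : ℤ → Bool) : branch (s 0) (codePoint s) = codePoint (shiftBy 1 s) := by
  have h1 := digitSum_eq fun j ↦ s j
  have h2 := digitSum_eq fun j ↦ s (-j)
  have e1 : (fun j : ℕ ↦ s (-((j + 1 : ℕ) : ℤ))) = fun j : ℕ ↦ s (-1 - j) := by
    ext j; congr 1; push_cast; ring
  have e2 : (fun j : ℕ ↦ s (-1 - j + 1)) = fun j : ℕ ↦ s (-j) := by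
    ext j; congr 1; ring
  rw [e1] at h2
  simp only [branch, codePoint, shiftBy, e2]
  simp only [Nat.cast_zero, neg_zero] at h1 h2
  ext i
  fin_cases i
  · simp
    push_cast at h1
    rw [h1]; ring
  · simp
  · simp
    rw [h2]; ring
  · simp

theorem continuous_codePoint : Continuous codePoint := by
  have h1 : Continuous fun s : ℤ → Bool ↦ digitSum fun j ↦ s j :=
    continuous_digitSum.comp (continuous_pi fun j ↦ continuous_apply _)
  have h2 : Continuous fun s : ℤ → Bool ↦ digitSum fun j ↦ s (-1 - j) :=
    continuous_digitSum.comp (continuous_pi fun j ↦ continuous_apply _)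
  refine (PiLp.continuous_toLp 2 _).comp (continuous_pi fun i ↦ ?_)
  fin_cases i
  · exact h1
  · exact continuous_const
  · exact continuous_const.mul h2
  · exact continuous_const

theorem norm_sq_lt_of_mem_branchBox {b : Bool} {y : EuclideanSpace ℝ (Fin 4)}
    (hy : y ∈ branchBox b) : ‖y‖ ^ 2 < 24 ∧ ‖branch b y‖ ^ 2 < 24 := by
  obtain ⟨h0, h1, h2, h3⟩ := hy
  rw [abs_lt] at h0 h1 h2 h3
  rw [norm_sq_four, norm_sq_four]
  have q1 : y 1 ^ 2 ≤ 1 / 16 := by nlinarith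
  have q3 : y 3 ^ 2 ≤ 1 / 16 := by nlinarith
  have q2 : y 2 ^ 2 ≤ (65 / 16) ^ 2 := by nlinarith
  have q0 : y 0 ^ 2 ≤ (17 / 16) ^ 2 := by
    cases b <;> simp at h0 <;> nlinarith
  have p0 : (4 * y 0 - (if b then 3 else 0)) ^ 2 ≤ (5 / 4) ^ 2 := by
    cases b <;> simp at h0 ⊢ <;> nlinarith
  have p2 : (y 2 / 4 + (if b then 3 else 0)) ^ 2 ≤ (65 / 64 + 3) ^ 2 := by
    cases b <;> simp <;> nlinarith
  refine ⟨by linarith, ?_⟩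
  have e : branch b y 0 ^ 2 + branch b y 1 ^ 2 + branch b y 2 ^ 2 + branch b y 3 ^ 2 =
      (4 * y 0 - (if b then 3 else 0)) ^ 2 + (4 * y 1) ^ 2 +
        (y 2 / 4 + (if b then 3 else 0)) ^ 2 + (y 3 / 4) ^ 2 := by
    simp [branch]
  rw [e]
  nlinarith

/-- The horseshoe diffeomorphism of the sphere. -/
noncomputable def horseshoe : S4 ≃ₘ⟮𝓡 4, 𝓡 4⟯ S4 := horseshoeConic.toDiffeomorph

theorem horseshoe_gnomonic {b : Bool} {y : EuclideanSpace ℝ (Fin 4)} (hy : y ∈ branchBox b) :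
    horseshoe (gnomonic y) = gnomonic (branch b y) :=
  sphereMap_gnomonic _ (horseshoeConic_liftOne hy)

/-- The point of the sphere with a given itinerary. -/
noncomputable def codeSphere (s : ℤ → Bool) : S4 := gnomonic (codePoint s)

theorem gnomonicInv_codeSphere (s : ℤ → Bool) : gnomonicInv (codeSphere s) = codePoint s :=
  gnomonicInv_gnomonic (norm_sq_lt_of_mem_branchBox (codePoint_mem_branchBox s)).1.le

theorem codeSphere_mem_upperCap (s : ℤ → Bool) : codeSphere s ∈ upperCap :=
  gnomonic_mem_upperCap (norm_sq_lt_of_mem_branchBox (codePoint_mem_branchBox s)).1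

theorem horseshoe_codeSphere (s : ℤ → Bool) :
    horseshoe (codeSphere s) = codeSphere (shiftBy 1 s) := by
  rw [codeSphere, horseshoe_gnomonic (codePoint_mem_branchBox s), branch_codePoint, codeSphere]

theorem horseshoe_iterate_codeSphere (n : ℕ) (s : ℤ → Bool) :
    horseshoe^[n] (codeSphere s) = codeSphere (shiftBy n s) := by
  induction n generalizing s with
  | zero => simp [shiftBy_zero]
  | succ n ih =>
    rw [Function.iterate_succ_apply, horseshoe_codeSphere, ih, shiftBy_shiftBy]
    push_cast; rfl

theorem horseshoe_symm_codeSphere (s : ℤ → Bool) :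
    horseshoe.symm (codeSphere s) = codeSphere (shiftBy (-1) s) := by
  have := horseshoe_codeSphere (shiftBy (-1) s)
  rw [shiftBy_shiftBy, add_neg_cancel, shiftBy_zero] at this
  rw [← this, horseshoe.symm_apply_apply]

theorem horseshoe_zpow_codeSphere (n : ℤ) (s : ℤ → Bool) :
    ((horseshoe.toEquiv : Equiv.Perm S4) ^ n) (codeSphere s) = codeSphere (shiftBy n s) := by
  induction n using Int.induction_on generalizing s with
  | zero => simp [shiftBy_zero]
  | succ n ih =>
    rw [zpow_add_one, Equiv.Perm.mul_apply]
    change (horseshoe.toEquiv ^ (n : ℤ)) (horseshoe (codeSphere s)) = _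
    rw [horseshoe_codeSphere, ih, shiftBy_shiftBy]
  | pred n ih =>
    rw [zpow_sub_one, Equiv.Perm.mul_apply]
    change (horseshoe.toEquiv ^ (-n : ℤ)) (horseshoe.symm (codeSphere s)) = _
    rw [horseshoe_symm_codeSphere, ih, shiftBy_shiftBy]
    rfl

theorem continuous_codeSphere : Continuous codeSphere :=
  contMDiff_gnomonic.continuous.comp continuous_codePoint

theorem apply_zero_eq_decide (s : ℤ → Bool) : s 0 = decide (1 / 2 ≤ codePoint s 0) := by
  obtain ⟨h, -⟩ := codePoint_mem_branchBox s
  rw [abs_lt] at h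
  cases hs : s 0 <;> simp [hs] at h ⊢ <;> linarith

/-- The symbol at time i is read off the first coordinate of the i-th image, on one side or the
other of 1/2. -/
theorem codeSphere_injective : Function.Injective codeSphere := by
  intro s s' h
  ext i
  have h1 := congrArg ((horseshoe.toEquiv : Equiv.Perm S4) ^ i) h
  rw [horseshoe_zpow_codeSphere, horseshoe_zpow_codeSphere] at h1
  have h2 := congrArg gnomonicInv h1
  rw [gnomonicInv_codeSphere, gnomonicInv_codeSphere] at h2
  have h3 := apply_zero_eq_decide (shiftBy i s)
  have h4 := apply_zero_eq_decide (shiftBy i s')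
  rw [h2, ← h4] at h3
  simpa [shiftBy] using h3

/-! ### Compactness, isolation and transitivity of the Cantor set. -/

/-- The Cantor set of the horseshoe. -/
def horseshoeSet : Set S4 := Set.range codeSphere

theorem isCompact_horseshoeSet : IsCompact horseshoeSet := isCompact_range continuous_codeSphere

theorem horseshoe_image_horseshoeSet : horseshoe '' horseshoeSet = horseshoeSet := by
  apply Set.Subset.antisymm
  · rintro _ ⟨_, ⟨s, rfl⟩, rfl⟩
    exact ⟨shiftBy 1 s, (horseshoe_codeSphere s).symm⟩
  · rintro _ ⟨s, rfl⟩
    refine ⟨_, ⟨shiftBy (-1) s, rfl⟩, ?_⟩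
    rw [horseshoe_codeSphere, shiftBy_shiftBy, add_neg_cancel, shiftBy_zero]

/-- The domain in the sphere where the horseshoe map is affine in the gnomonic chart. -/
def branchDomain (b : Bool) : Set S4 := {x ∈ upperCap | gnomonicInv x ∈ branchBox b}

theorem isOpen_branchBox (b : Bool) : IsOpen (branchBox b) := by
  have h (i : Fin 4) : Continuous fun y : EuclideanSpace ℝ (Fin 4) ↦ y i := by fun_prop
  exact (isOpen_lt ((h 0).sub continuous_const).abs continuous_const).inter
    ((isOpen_lt (h 1).abs continuous_const).inter
      ((isOpen_lt ((h 2).sub continuous_const).abs continuous_const).inter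
        (isOpen_lt (h 3).abs continuous_const)))

theorem isOpen_branchDomain (b : Bool) : IsOpen (branchDomain b) :=
  isOpen_upperCap.inter ((isOpen_branchBox b).preimage contMDiff_gnomonicInv.continuous)

theorem codeSphere_mem_branchDomain (s : ℤ → Bool) : codeSphere s ∈ branchDomain (s 0) :=
  ⟨codeSphere_mem_upperCap s, by
    rw [gnomonicInv_codeSphere]; exact codePoint_mem_branchBox s⟩

theorem gnomonicInv_horseshoe {b : Bool} {x : S4} (hx : x ∈ branchDomain b) :
    gnomonicInv (horseshoe x) = branch b (gnomonicInv x) := by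
  conv_lhs => rw [← (gnomonic_gnomonicInv hx.1).1]
  rw [horseshoe_gnomonic hx.2, gnomonicInv_gnomonic (norm_sq_lt_of_mem_branchBox hx.2).2.le]

theorem eq_zero_of_expanding {a : ℕ → ℝ} {C : ℝ} (hC : ∀ n, |a n| ≤ C)
    (ha : ∀ n, a (n + 1) = 4 * a n) : a 0 = 0 := by
  have h (n : ℕ) : a n = 4 ^ n * a 0 := by
    induction n with
    | zero => simp
    | succ n ih => rw [ha, ih]; ring
  by_contra h0
  have hpos : 0 < |a 0| := abs_pos.2 h0
  obtain ⟨n, hn⟩ := pow_unbounded_of_one_lt (C / |a 0|) (by norm_num : (1 : ℝ) < 4)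
  rw [div_lt_iff₀ hpos] at hn
  have := hC n
  rw [h, abs_mul, abs_of_pos (by positivity)] at this
  linarith

/-- A point whose affine orbit stays in the branch boxes is determined by its itinerary. -/
theorem eq_codePoint_of_orbit {y : ℤ → EuclideanSpace ℝ (Fin 4)} {s : ℤ → Bool}
    (hy : ∀ n, y n ∈ branchBox (s n)) (hb : ∀ n, y (n + 1) = branch (s n) (y n)) :
    y 0 = codePoint s := by
  set z : ℤ → EuclideanSpace ℝ (Fin 4) := fun n ↦ codePoint (shiftBy n s) with hz
  have hzm (n : ℤ) : z n ∈ branchBox (s n) := by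
    simpa [shiftBy] using codePoint_mem_branchBox (shiftBy n s)
  have hzb (n : ℤ) : z (n + 1) = branch (s n) (z n) := by
    have := branch_codePoint (shiftBy n s)
    rw [shiftBy_shiftBy, add_comm] at this
    simpa [shiftBy] using this.symm
  have hz0 : z 0 = codePoint s := by simp [hz, shiftBy_zero]
  -- The widest side of a box has length 33/8, so 5 bounds all coordinate differences.
  have hbd (n : ℤ) (i : Fin 4) : |y n i - z n i| ≤ 5 := by
    obtain ⟨a0, a1, a2, a3⟩ := hy n
    obtain ⟨b0, b1, b2, b3⟩ := hzm n
    rw [abs_lt] at a0 a1 a2 a3 b0 b1 b2 b3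
    rw [abs_le]
    fin_cases i <;> simp only [Fin.zero_eta, Fin.mk_one, Fin.reduceFinMk] <;>
      constructor <;> linarith
  have f0 (n : ℤ) : y (n + 1) 0 - z (n + 1) 0 = 4 * (y n 0 - z n 0) := by
    rw [hb, hzb]; simp [branch]; ring
  have f1 (n : ℤ) : y (n + 1) 1 - z (n + 1) 1 = 4 * (y n 1 - z n 1) := by
    rw [hb, hzb]; simp [branch]; ring
  have f2 (n : ℤ) : y n 2 - z n 2 = 4 * (y (n + 1) 2 - z (n + 1) 2) := by
    rw [hb, hzb]; simp [branch]; ring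
  have f3 (n : ℤ) : y n 3 - z n 3 = 4 * (y (n + 1) 3 - z (n + 1) 3) := by
    rw [hb, hzb]; simp [branch]; ring
  have e (n : ℕ) : (-(n + 1 : ℕ) : ℤ) + 1 = -(n : ℤ) := by push_cast; ring
  rw [← hz0]
  ext i
  rw [← sub_eq_zero]
  fin_cases i
  -- The difference of two orbits with the same itinerary is multiplied by 4 in forward time in the
  -- coordinates 0 and 1, and in backward time in the coordinates 2 and 3; being bounded, it
  -- vanishes.
  · exact eq_zero_of_expanding (a := fun n ↦ y n 0 - z n 0) (fun n ↦ hbd n 0) fun n ↦ f0 n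
  · exact eq_zero_of_expanding (a := fun n ↦ y n 1 - z n 1) (fun n ↦ hbd n 1) fun n ↦ f1 n
  · exact eq_zero_of_expanding (a := fun n ↦ y (-n) 2 - z (-n) 2) (fun n ↦ hbd (-n) 2)
      fun n ↦ by rw [f2, e]
  · exact eq_zero_of_expanding (a := fun n ↦ y (-n) 3 - z (-n) 3) (fun n ↦ hbd (-n) 3)
      fun n ↦ by rw [f3, e]

/-- An orbit that stays in the union of the branch domains follows the affine branches, so it has an
itinerary, and this itinerary determines the point. -/
theorem horseshoeSet_isolated : ∃ V ∈ 𝓝ˢ horseshoeSet,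
    horseshoeSet = ⋂ n : ℤ, ((horseshoe.toEquiv : Equiv.Perm S4) ^ n) '' V := by
  set τ : Equiv.Perm S4 := horseshoe.toEquiv with hτ
  refine ⟨⋃ b, branchDomain b, ?_, ?_⟩
  · refine (isOpen_iUnion isOpen_branchDomain).mem_nhdsSet.2 ?_
    rintro _ ⟨s, rfl⟩
    exact Set.mem_iUnion.2 ⟨_, codeSphere_mem_branchDomain s⟩
  · apply Set.Subset.antisymm
    · rintro _ ⟨s, rfl⟩
      refine Set.mem_iInter.2 fun n ↦ ⟨codeSphere (shiftBy (-n) s),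
        Set.mem_iUnion.2 ⟨_, codeSphere_mem_branchDomain _⟩, ?_⟩
      rw [horseshoe_zpow_codeSphere, shiftBy_shiftBy, add_neg_cancel, shiftBy_zero]
    · intro x hx
      have h (n : ℤ) : ∃ b, (τ ^ n) x ∈ branchDomain b := by
        obtain ⟨y, hy, hyx⟩ := Set.mem_iInter.1 hx (-n)
        rw [← hyx, ← Equiv.Perm.mul_apply, ← zpow_add, add_neg_cancel]
        simpa using hy
      choose s hs using h
      have key := eq_codePoint_of_orbit (y := fun n ↦ gnomonicInv ((τ ^ n) x)) (s := s)
        (fun n ↦ (hs n).2) fun n ↦ by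
          rw [← gnomonicInv_horseshoe (hs n), add_comm, zpow_add, zpow_one]; rfl
      have hx0 : x ∈ upperCap := by simpa using (hs 0).1
      refine ⟨s, ?_⟩
      rw [codeSphere, ← key]
      simpa using (gnomonic_gnomonicInv hx0).1

open Filter in
theorem horseshoeSet_transitive (A B : Set S4) (hA : IsOpen A) (hB : IsOpen B)
    (hAK : (A ∩ horseshoeSet).Nonempty) (hBK : (B ∩ horseshoeSet).Nonempty) :
    ∃ n : ℕ, (horseshoe^[n] '' (A ∩ horseshoeSet) ∩ B).Nonempty := by
  obtain ⟨_, hsA, s, rfl⟩ := hAK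
  obtain ⟨_, hsB, s', rfl⟩ := hBK
  -- The sequence agrees with s before N and with s' moved to 2N from N on. Thus it tends to s,
  -- while its shift by 2N tends to s'.
  set φ : ℕ → ℤ → Bool := fun N i ↦ if i < N then s i else s' (i - 2 * N) with hφ
  have h1 : Tendsto φ atTop (𝓝 s) := by
    refine tendsto_pi_nhds.2 fun i ↦ tendsto_const_nhds.congr' ?_
    filter_upwards [eventually_gt_atTop i.toNat] with N hN
    rw [hφ]; simp only
    rw [if_pos (by omega)]
  have h2 : Tendsto (fun N : ℕ ↦ shiftBy ((2 * N : ℕ) : ℤ) (φ N)) atTop (𝓝 s') := by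
    refine tendsto_pi_nhds.2 fun i ↦ tendsto_const_nhds.congr' ?_
    filter_upwards [eventually_gt_atTop (-i).toNat] with N hN
    rw [hφ, shiftBy]; simp only
    rw [if_neg (by omega)]
    congr 1
    push_cast; ring
  have h3 := (continuous_codeSphere.tendsto s).comp h1 |>.eventually (hA.mem_nhds hsA)
  have h4 := (continuous_codeSphere.tendsto s').comp h2 |>.eventually (hB.mem_nhds hsB)
  obtain ⟨N, hNA, hNB⟩ := (h3.and h4).exists
  refine ⟨2 * N, codeSphere (shiftBy ((2 * N : ℕ) : ℤ) (φ N)), ⟨codeSphere (φ N), ⟨hNA, _, rfl⟩, ?_⟩,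
    hNB⟩
  rw [horseshoe_iterate_codeSphere]

/-! ### Hyperbolicity. -/

/-- The derivative of the gnomonic chart, as a map to `ℝ⁴`. -/
noncomputable def chartDeriv (x : S4) :
    EuclideanSpace ℝ (Fin 4) →L[ℝ] EuclideanSpace ℝ (Fin 4) :=
  mfderiv (𝓡 4) 𝓘(ℝ, EuclideanSpace ℝ (Fin 4)) gnomonicInv x

/-- The pullback of the Euclidean inner product under a linear map. -/
noncomputable def pullbackInner (A : EuclideanSpace ℝ (Fin 4) →L[ℝ] EuclideanSpace ℝ (Fin 4)) :
    EuclideanSpace ℝ (Fin 4) →L[ℝ] EuclideanSpace ℝ (Fin 4) →L[ℝ] ℝ :=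
  (innerSL ℝ : EuclideanSpace ℝ (Fin 4) →L[ℝ] EuclideanSpace ℝ (Fin 4) →L[ℝ] ℝ).bilinearComp A A

theorem pullbackInner_apply (A : EuclideanSpace ℝ (Fin 4) →L[ℝ] EuclideanSpace ℝ (Fin 4))
    (v w : EuclideanSpace ℝ (Fin 4)) : pullbackInner A v w = inner ℝ (A v) (A w) := rfl

theorem contDiff_pullbackInner : ContDiff ℝ ∞ pullbackInner := by
  refine contDiff_clm_apply_iff.2 fun v ↦ contDiff_clm_apply_iff.2 fun w ↦ ?_
  simp only [pullbackInner_apply]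
  exact (contDiff_id.clm_apply contDiff_const).inner ℝ (contDiff_id.clm_apply contDiff_const)

/-- The pullback of the Euclidean inner product under the gnomonic chart. -/
noncomputable def chartInner (x : S4) :
    TangentSpace (𝓡 4) x →L[ℝ] TangentSpace (𝓡 4) x →L[ℝ] ℝ :=
  pullbackInner (chartDeriv x)

theorem chartInner_apply (x : S4) (v w : EuclideanSpace ℝ (Fin 4)) :
    chartInner x v w = inner ℝ (chartDeriv x v) (chartDeriv x w) := rfl

/-- In a trivialization of the tangent bundle, the form is `pullbackInner` of the derivative of
`gnomonicInv` in coordinates, and this derivative is smooth. Only nondegeneracy requires the cap. -/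
theorem contMDiff_chartInner : ContMDiff (𝓡 4)
    ((𝓡 4).prod 𝓘(ℝ, EuclideanSpace ℝ (Fin 4) →L[ℝ] EuclideanSpace ℝ (Fin 4) →L[ℝ] ℝ)) ∞
    (fun x ↦ Bundle.TotalSpace.mk'
      (EuclideanSpace ℝ (Fin 4) →L[ℝ] EuclideanSpace ℝ (Fin 4) →L[ℝ] ℝ)
      (E := fun x : S4 ↦ TangentSpace (𝓡 4) x →L[ℝ] TangentSpace (𝓡 4) x →L[ℝ] ℝ)
      x (chartInner x)) := by
  intro x₀
  rw [contMDiffAt_hom_bundle]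
  refine ⟨contMDiffAt_id, ?_⟩
  have h1 : ContMDiffAt (𝓡 4) 𝓘(ℝ, EuclideanSpace ℝ (Fin 4) →L[ℝ] EuclideanSpace ℝ (Fin 4)) ∞
      (inTangentCoordinates (𝓡 4) 𝓘(ℝ, EuclideanSpace ℝ (Fin 4)) id gnomonicInv
        (mfderiv (𝓡 4) 𝓘(ℝ, EuclideanSpace ℝ (Fin 4)) gnomonicInv) x₀) x₀ :=
    (contMDiff_gnomonicInv x₀).mfderiv_const (by simp)
  refine (contDiff_pullbackInner.contMDiff.contMDiffAt.comp x₀ h1).congr_of_eventuallyEq ?_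
  have hb : ∀ᶠ x in 𝓝 x₀, x ∈ (trivializationAt (EuclideanSpace ℝ (Fin 4))
      (TangentSpace (𝓡 4) : S4 → Type _) x₀).baseSet :=
    (trivializationAt (EuclideanSpace ℝ (Fin 4))
      (TangentSpace (𝓡 4) : S4 → Type _) x₀).open_baseSet.mem_nhds
      (FiberBundle.mem_baseSet_trivializationAt' x₀)
  filter_upwards [hb] with x hx
  ext v w
  rw [inCoordinates_apply_eq₂ hx hx (by simp)]
  have hA : inTangentCoordinates (𝓡 4) 𝓘(ℝ, EuclideanSpace ℝ (Fin 4)) id gnomonicInv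
      (mfderiv (𝓡 4) 𝓘(ℝ, EuclideanSpace ℝ (Fin 4)) gnomonicInv) x₀ x =
      (chartDeriv x).comp ((trivializationAt (EuclideanSpace ℝ (Fin 4))
        (TangentSpace (𝓡 4) : S4 → Type _) x₀).symmL ℝ x) := by
    simp [inTangentCoordinates, ContinuousLinearMap.inCoordinates]
    rfl
  rw [Function.comp_apply, hA, pullbackInner_apply,
    ← Bundle.Trivialization.symmL_apply (R := ℝ) _ hx,
    ← Bundle.Trivialization.symmL_apply (R := ℝ) _ hx]
  simp
  rfl

theorem mdifferentiable_gnomonicInv :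
    MDifferentiable (𝓡 4) 𝓘(ℝ, EuclideanSpace ℝ (Fin 4)) gnomonicInv :=
  contMDiff_gnomonicInv.mdifferentiable (by simp)

theorem mdifferentiable_gnomonic : MDifferentiable (𝓡 4) (𝓡 4) gnomonic :=
  contMDiff_gnomonic.mdifferentiable (by simp)

/-- The derivative of the inverse of the gnomonic chart, as a map on `ℝ⁴`. -/
noncomputable def chartDerivInv (x : S4) :
    EuclideanSpace ℝ (Fin 4) →L[ℝ] EuclideanSpace ℝ (Fin 4) :=
  mfderiv (𝓡 4) (𝓡 4) gnomonic (gnomonicInv x)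

theorem chartDeriv_comp_chartDerivInv {x : S4} (hx : x ∈ upperCap) (v : EuclideanSpace ℝ (Fin 4)) :
    chartDeriv x (chartDerivInv x v) = v := by
  obtain ⟨h1, h2⟩ := gnomonic_gnomonicInv hx
  have hev : gnomonicInv ∘ gnomonic =ᶠ[𝓝 (gnomonicInv x)] id := by
    have : {y : EuclideanSpace ℝ (Fin 4) | ‖y‖ ^ 2 < 24} ∈ 𝓝 (gnomonicInv x) :=
      (isOpen_lt (by fun_prop) continuous_const).mem_nhds h2
    filter_upwards [this] with y hy using gnomonicInv_gnomonic (le_of_lt hy)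
  have h3 := mfderiv_comp (gnomonicInv x) (mdifferentiable_gnomonicInv (gnomonic (gnomonicInv x)))
    (mdifferentiable_gnomonic (gnomonicInv x))
  rw [hev.mfderiv_eq, mfderiv_id] at h3
  have h4 : (chartDeriv (gnomonic (gnomonicInv x))).comp (chartDerivInv x) =
    ContinuousLinearMap.id ℝ (EuclideanSpace ℝ (Fin 4)) := h3.symm
  rw [h1] at h4
  exact congrArg (fun A : EuclideanSpace ℝ (Fin 4) →L[ℝ] EuclideanSpace ℝ (Fin 4) ↦ A v) h4

theorem chartDerivInv_comp_chartDeriv {x : S4} (hx : x ∈ upperCap) (v : EuclideanSpace ℝ (Fin 4)) :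
    chartDerivInv x (chartDeriv x v) = v := by
  have hev : gnomonic ∘ gnomonicInv =ᶠ[𝓝 x] id := by
    filter_upwards [isOpen_upperCap.mem_nhds hx] with y hy using (gnomonic_gnomonicInv hy).1
  have h3 := mfderiv_comp x (mdifferentiable_gnomonic (gnomonicInv x))
    (mdifferentiable_gnomonicInv x)
  rw [hev.mfderiv_eq, mfderiv_id] at h3
  exact congrArg (fun A : EuclideanSpace ℝ (Fin 4) →L[ℝ] EuclideanSpace ℝ (Fin 4) ↦ A v) h3.symm

/-- The derivative of the gnomonic chart as an isomorphism. -/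
noncomputable def chartDerivEquiv {x : S4} (hx : x ∈ upperCap) :
    EuclideanSpace ℝ (Fin 4) ≃ₗ[ℝ] EuclideanSpace ℝ (Fin 4) :=
  LinearEquiv.ofLinearMap (chartDeriv x).toLinearMap (chartDerivInv x).toLinearMap
    (LinearMap.ext fun v ↦ chartDeriv_comp_chartDerivInv hx v)
    (LinearMap.ext fun v ↦ chartDerivInv_comp_chartDeriv hx v)

theorem chartDeriv_injective {x : S4} (hx : x ∈ upperCap) : Function.Injective (chartDeriv x) :=
  (chartDerivEquiv hx).injective

/-- The Euclidean metric of the gnomonic chart. -/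
noncomputable def gnomonicMetric : LocalRiemannianMetric 4 S4 upperCap where
  inner := chartInner
  isOpen_domain := isOpen_upperCap
  symm x _ v w := (chartInner_apply x v w).trans
    ((real_inner_comm _ _).trans (chartInner_apply x w v).symm)
  pos x hx v hv := by
    refine (real_inner_self_pos.2 fun h ↦ hv ?_).trans_eq (chartInner_apply x v v).symm
    exact chartDeriv_injective hx (h.trans (map_zero (chartDeriv x)).symm)
  contMDiffOn := contMDiff_chartInner.contMDiffOn

theorem tnorm_gnomonicMetric (x : S4) (v : EuclideanSpace ℝ (Fin 4)) :
    gnomonicMetric.tnorm x v = ‖chartDeriv x v‖ := by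
  change Real.sqrt (chartInner x v v) = _
  rw [norm_eq_sqrt_real_inner, chartInner_apply]

/-- The diagonal map of `ℝ⁴` with entries `4, 4, 1/4, 1/4`. -/
noncomputable def linearPart : EuclideanSpace ℝ (Fin 4) →L[ℝ] EuclideanSpace ℝ (Fin 4) :=
  (Matrix.toEuclideanLin (Matrix.diagonal ![4, 4, 4⁻¹, 4⁻¹])).toContinuousLinearMap

/-- The diagonal map of `ℝ⁴` with entries `1/4, 1/4, 4, 4`. -/
noncomputable def linearPartInv : EuclideanSpace ℝ (Fin 4) →L[ℝ] EuclideanSpace ℝ (Fin 4) :=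
  (Matrix.toEuclideanLin (Matrix.diagonal ![4⁻¹, 4⁻¹, 4, 4])).toContinuousLinearMap

theorem linearPart_apply (y : EuclideanSpace ℝ (Fin 4)) :
    linearPart y = !₂[4 * y 0, 4 * y 1, 4⁻¹ * y 2, 4⁻¹ * y 3] := by
  ext i
  fin_cases i <;> simp [linearPart, Matrix.toLpLin_apply, Matrix.mulVec_diagonal]

theorem linearPartInv_apply (y : EuclideanSpace ℝ (Fin 4)) :
    linearPartInv y = !₂[4⁻¹ * y 0, 4⁻¹ * y 1, 4 * y 2, 4 * y 3] := by
  ext i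
  fin_cases i <;> simp [linearPartInv, Matrix.toLpLin_apply, Matrix.mulVec_diagonal]

theorem linearPart_linearPartInv (y : EuclideanSpace ℝ (Fin 4)) :
    linearPart (linearPartInv y) = y := by
  rw [linearPart_apply, linearPartInv_apply]
  ext i; fin_cases i <;> simp

theorem linearPartInv_linearPart (y : EuclideanSpace ℝ (Fin 4)) :
    linearPartInv (linearPart y) = y := by
  rw [linearPart_apply, linearPartInv_apply]
  ext i; fin_cases i <;> simp

theorem hasFDerivAt_branch (b : Bool) (y : EuclideanSpace ℝ (Fin 4)) :
    HasFDerivAt (branch b) linearPart y := by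
  have h : branch b = fun y ↦ linearPart y + !₂[-(if b then 3 else 0), 0, if b then 3 else 0, 0] := by
    ext y i
    rw [linearPart_apply]
    fin_cases i <;> simp [branch] <;> ring
  rw [h]
  exact linearPart.hasFDerivAt.add_const _

theorem mdifferentiable_horseshoe : MDifferentiable (𝓡 4) (𝓡 4) horseshoe :=
  horseshoe.contMDiff.mdifferentiable (by simp)

theorem mdifferentiable_horseshoe_symm : MDifferentiable (𝓡 4) (𝓡 4) horseshoe.symm :=
  horseshoe.symm.contMDiff.mdifferentiable (by simp)

/-- The two branches differ by a translation, so in the chart the derivative is the same diagonal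
matrix at every point. -/
theorem chartDeriv_mfderiv_horseshoe {b : Bool} {x : S4} (hx : x ∈ branchDomain b)
    (v : EuclideanSpace ℝ (Fin 4)) :
    chartDeriv (horseshoe x) (mfderiv (𝓡 4) (𝓡 4) horseshoe x v) = linearPart (chartDeriv x v) := by
  have hev : gnomonicInv ∘ horseshoe =ᶠ[𝓝 x] branch b ∘ gnomonicInv := by
    filter_upwards [(isOpen_branchDomain b).mem_nhds hx] with y hy using gnomonicInv_horseshoe hy
  have h1 := mfderiv_comp x (mdifferentiable_gnomonicInv (horseshoe x)) (mdifferentiable_horseshoe x)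
  have h2 := mfderiv_comp (I'' := 𝓘(ℝ, EuclideanSpace ℝ (Fin 4))) x
    (hasFDerivAt_branch b (gnomonicInv x)).hasMFDerivAt.mdifferentiableAt
    (mdifferentiable_gnomonicInv x)
  rw [hev.mfderiv_eq, h2, (hasFDerivAt_branch b (gnomonicInv x)).hasMFDerivAt.mfderiv] at h1
  exact congrArg (fun A : EuclideanSpace ℝ (Fin 4) →L[ℝ] EuclideanSpace ℝ (Fin 4) ↦ A v) h1.symm

theorem chartDeriv_mfderiv_horseshoe_symm {b : Bool} {x : S4}
    (hx : horseshoe.symm x ∈ branchDomain b) (v : EuclideanSpace ℝ (Fin 4)) :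
    chartDeriv (horseshoe.symm x) (mfderiv (𝓡 4) (𝓡 4) horseshoe.symm x v) =
      linearPartInv (chartDeriv x v) := by
  have hev : gnomonicInv =ᶠ[𝓝 x] (branch b ∘ gnomonicInv) ∘ horseshoe.symm := by
    filter_upwards [horseshoe.symm.continuous.continuousAt.preimage_mem_nhds
      ((isOpen_branchDomain b).mem_nhds hx)] with y hy
    rw [Function.comp_apply, Function.comp_apply, ← gnomonicInv_horseshoe hy,
      horseshoe.apply_symm_apply]
  have hb := (hasFDerivAt_branch b (gnomonicInv (horseshoe.symm x))).hasMFDerivAt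
  have h2 := mfderiv_comp (I'' := 𝓘(ℝ, EuclideanSpace ℝ (Fin 4))) (horseshoe.symm x)
    hb.mdifferentiableAt (mdifferentiable_gnomonicInv (horseshoe.symm x))
  have h1 := mfderiv_comp (I'' := 𝓘(ℝ, EuclideanSpace ℝ (Fin 4))) x
    (hb.mdifferentiableAt.comp _ (mdifferentiable_gnomonicInv (horseshoe.symm x)))
    (mdifferentiable_horseshoe_symm x)
  rw [← hev.mfderiv_eq, h2, hb.mfderiv] at h1
  have h3 : chartDeriv x v = linearPart (chartDeriv (horseshoe.symm x)
      (mfderiv (𝓡 4) (𝓡 4) horseshoe.symm x v)) :=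
    congrArg (fun A : EuclideanSpace ℝ (Fin 4) →L[ℝ] EuclideanSpace ℝ (Fin 4) ↦ A v) h1
  rw [h3, linearPartInv_linearPart]

theorem horseshoe_mem {x : S4} (hx : x ∈ horseshoeSet) : horseshoe x ∈ horseshoeSet := by
  rw [← horseshoe_image_horseshoeSet]; exact ⟨x, hx, rfl⟩

theorem horseshoe_symm_mem {x : S4} (hx : x ∈ horseshoeSet) :
    horseshoe.symm x ∈ horseshoeSet := by
  obtain ⟨s, rfl⟩ := hx
  exact ⟨_, (horseshoe_symm_codeSphere s).symm⟩

theorem exists_mem_branchDomain {x : S4} (hx : x ∈ horseshoeSet) : ∃ b, x ∈ branchDomain b := by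
  obtain ⟨s, rfl⟩ := hx
  exact ⟨_, codeSphere_mem_branchDomain s⟩

theorem horseshoeSet_subset_upperCap : horseshoeSet ⊆ upperCap := by
  rintro _ ⟨s, rfl⟩
  exact codeSphere_mem_upperCap s

theorem chartDeriv_mfderiv_iterate (n : ℕ) {x : S4} (hx : x ∈ horseshoeSet)
    (v : EuclideanSpace ℝ (Fin 4)) :
    chartDeriv (horseshoe^[n] x) (mfderiv (𝓡 4) (𝓡 4) (horseshoe^[n]) x v) =
      linearPart^[n] (chartDeriv x v) := by
  induction n generalizing x v with
  | zero => simp only [Function.iterate_zero, mfderiv_id]; rfl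
  | succ n ih =>
    have hd : MDifferentiable (𝓡 4) (𝓡 4) (horseshoe^[n]) := by
      clear ih
      induction n with
      | zero => exact mdifferentiable_id
      | succ n ih => exact ih.comp mdifferentiable_horseshoe
    obtain ⟨b, hb⟩ := exists_mem_branchDomain hx
    have h := mfderiv_comp x (hd (horseshoe x)) (mdifferentiable_horseshoe x)
    refine Eq.trans ?_ ((ih (horseshoe_mem hx) (mfderiv (𝓡 4) (𝓡 4) horseshoe x v)).trans
      (congrArg linearPart^[n] (chartDeriv_mfderiv_horseshoe hb v)))
    exact congrArg (fun A : EuclideanSpace ℝ (Fin 4) →L[ℝ] EuclideanSpace ℝ (Fin 4) ↦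
      chartDeriv (horseshoe^[n] (horseshoe x)) (A v)) h

theorem chartDeriv_mfderiv_symm_iterate (n : ℕ) {x : S4} (hx : x ∈ horseshoeSet)
    (v : EuclideanSpace ℝ (Fin 4)) :
    chartDeriv (horseshoe.symm^[n] x) (mfderiv (𝓡 4) (𝓡 4) (horseshoe.symm^[n]) x v) =
      linearPartInv^[n] (chartDeriv x v) := by
  induction n generalizing x v with
  | zero => simp only [Function.iterate_zero, mfderiv_id]; rfl
  | succ n ih =>
    have hd : MDifferentiable (𝓡 4) (𝓡 4) (horseshoe.symm^[n]) := by
      clear ih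
      induction n with
      | zero => exact mdifferentiable_id
      | succ n ih => exact ih.comp mdifferentiable_horseshoe_symm
    obtain ⟨b, hb⟩ := exists_mem_branchDomain (horseshoe_symm_mem hx)
    have h := mfderiv_comp x (hd (horseshoe.symm x)) (mdifferentiable_horseshoe_symm x)
    refine Eq.trans ?_ ((ih (horseshoe_symm_mem hx) (mfderiv (𝓡 4) (𝓡 4) horseshoe.symm x v)).trans
      (congrArg linearPartInv^[n] (chartDeriv_mfderiv_horseshoe_symm hb v)))
    exact congrArg (fun A : EuclideanSpace ℝ (Fin 4) →L[ℝ] EuclideanSpace ℝ (Fin 4) ↦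
      chartDeriv (horseshoe.symm^[n] (horseshoe.symm x)) (A v)) h

/-- The kernel of two coordinates in `ℝ⁴`. -/
def coordPlane (i j : Fin 4) : Submodule ℝ (EuclideanSpace ℝ (Fin 4)) where
  carrier := {y | y i = 0 ∧ y j = 0}
  add_mem' := by
    rintro a b ⟨h1, h2⟩ ⟨h3, h4⟩
    simp [h1, h2, h3, h4]
  zero_mem' := by simp
  smul_mem' := by
    rintro c a ⟨h1, h2⟩
    simp [h1, h2]

theorem mem_coordPlane {i j : Fin 4} {y : EuclideanSpace ℝ (Fin 4)} :
    y ∈ coordPlane i j ↔ y i = 0 ∧ y j = 0 := Iff.rfl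

/-- The preimage of a coordinate plane under the derivative of the gnomonic chart. -/
noncomputable def planeField (i j : Fin 4) (x : S4) : Submodule ℝ (TangentSpace (𝓡 4) x) :=
  (coordPlane i j).comap (chartDeriv x).toLinearMap

theorem mem_planeField {i j : Fin 4} {x : S4} {v : EuclideanSpace ℝ (Fin 4)} :
    v ∈ planeField i j x ↔ chartDeriv x v ∈ coordPlane i j := Iff.rfl

theorem isCompl_planeField {x : S4} (hx : x ∈ upperCap) :
    IsCompl (planeField 2 3 x) (planeField 0 1 x) := by
  constructor
  · rw [Submodule.disjoint_def]
    intro v h1 h2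
    obtain ⟨a2, a3⟩ := mem_planeField.1 h1
    obtain ⟨a0, a1⟩ := mem_planeField.1 h2
    have : chartDeriv x v = 0 := by
      ext i; fin_cases i <;> simpa
    exact chartDeriv_injective hx (this.trans (map_zero (chartDeriv x)).symm)
  · rw [Submodule.codisjoint_iff_exists_add_eq]
    intro v
    set y : EuclideanSpace ℝ (Fin 4) := chartDeriv x v with hy
    refine ⟨chartDerivInv x !₂[y 0, y 1, 0, 0], chartDerivInv x !₂[0, 0, y 2, y 3], ?_, ?_, ?_⟩
    · refine mem_planeField.2 ((chartDeriv_comp_chartDerivInv hx _).symm ▸ ?_)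
      simp [mem_coordPlane]
    · refine mem_planeField.2 ((chartDeriv_comp_chartDerivInv hx _).symm ▸ ?_)
      simp [mem_coordPlane]
    · have : (!₂[y 0, y 1, 0, 0] : EuclideanSpace ℝ (Fin 4)) + !₂[0, 0, y 2, y 3] = y := by
        ext i; fin_cases i <;> simp
      refine ((chartDerivInv x).map_add _ _).symm.trans ?_
      rw [this, hy]
      exact chartDerivInv_comp_chartDeriv hx v

/-- The chart derivative conjugates the claim to the invariance of a coordinate plane under a
diagonal map. -/
theorem map_planeField {i j : Fin 4}
    (h : ∀ y, linearPart y ∈ coordPlane i j ↔ y ∈ coordPlane i j) {x : S4}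
    (hx : x ∈ horseshoeSet) :
    (planeField i j x).map (mfderiv (𝓡 4) (𝓡 4) horseshoe x).toLinearMap =
      planeField i j (horseshoe x) := by
  obtain ⟨b, hb⟩ := exists_mem_branchDomain hx
  have hd := chartDeriv_mfderiv_horseshoe hb
  have hxU := horseshoeSet_subset_upperCap hx
  have hTU := horseshoeSet_subset_upperCap (horseshoe_mem hx)
  apply le_antisymm
  · rintro _ ⟨v, hv, rfl⟩
    refine mem_planeField.2 ((hd v).symm ▸ ?_)
    exact (h _).2 (mem_planeField.1 hv)
  · intro w hw
    have e : chartDeriv x (chartDerivInv x (linearPartInv (chartDeriv (horseshoe x) w))) =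
        linearPartInv (chartDeriv (horseshoe x) w) := chartDeriv_comp_chartDerivInv hxU _
    refine ⟨chartDerivInv x (linearPartInv (chartDeriv (horseshoe x) w)), ?_, ?_⟩
    · refine mem_planeField.2 (e.symm ▸ ?_)
      rw [← h, linearPart_linearPartInv]
      exact hw
    · apply chartDeriv_injective hTU
      refine (hd _).trans ?_
      rw [e, linearPart_linearPartInv]

theorem iterate_eq_smul {A : EuclideanSpace ℝ (Fin 4) →L[ℝ] EuclideanSpace ℝ (Fin 4)} {c : ℝ}
    {y : EuclideanSpace ℝ (Fin 4)} (h : A y = c • y) (n : ℕ) : A^[n] y = c ^ n • y := by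
  induction n with
  | zero => simp
  | succ n ih => rw [Function.iterate_succ_apply', ih, map_smul, h, smul_smul, pow_succ]

theorem isHyperbolicSet_horseshoeSet : IsHyperbolicSet horseshoe horseshoeSet := by
  refine ⟨upperCap, gnomonicMetric, planeField 2 3, planeField 0 1, 4, 1,
    horseshoeSet_subset_upperCap, by norm_num, one_pos, fun x hx ↦
    ⟨isCompl_planeField (horseshoeSet_subset_upperCap hx), map_planeField (fun y ↦ ?_) hx,
      map_planeField (fun y ↦ ?_) hx, fun n v hv ↦ ?_, fun n v hv ↦ ?_⟩⟩
  · simp [mem_coordPlane, linearPart_apply]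
  · simp [mem_coordPlane, linearPart_apply]
  · obtain ⟨h0, h1⟩ := mem_planeField.1 hv
    have e : linearPart (chartDeriv x v) = (4⁻¹ : ℝ) • chartDeriv x v := by
      rw [linearPart_apply]
      ext i; fin_cases i <;> simp [h0, h1]
    have e2 := chartDeriv_mfderiv_iterate n hx v
    rw [iterate_eq_smul e] at e2
    refine (tnorm_gnomonicMetric _ _).trans_le (le_of_eq (Eq.trans ?_
      (congrArg (1 * ((4 : ℝ) ^ n)⁻¹ * ·) (tnorm_gnomonicMetric x v).symm)))
    rw [e2, norm_smul, one_mul, inv_pow, Real.norm_of_nonneg (by positivity)]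
  · obtain ⟨h0, h1⟩ := mem_planeField.1 hv
    have e : linearPartInv (chartDeriv x v) = (4⁻¹ : ℝ) • chartDeriv x v := by
      rw [linearPartInv_apply]
      ext i; fin_cases i <;> simp [h0, h1]
    have e2 := chartDeriv_mfderiv_symm_iterate n hx v
    rw [iterate_eq_smul e] at e2
    refine (tnorm_gnomonicMetric _ _).trans_le (le_of_eq (Eq.trans ?_
      (congrArg (1 * ((4 : ℝ) ^ n)⁻¹ * ·) (tnorm_gnomonicMetric x v).symm)))
    rw [e2, norm_smul, one_mul, inv_pow, Real.norm_of_nonneg (by positivity)]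

theorem isHyperbolicBasicSet_horseshoeSet : IsHyperbolicBasicSet horseshoe horseshoeSet where
  isCompact := isCompact_horseshoeSet
  invariant := horseshoe_image_horseshoeSet
  hyperbolic := isHyperbolicSet_horseshoeSet
  isolated := horseshoeSet_isolated
  transitive := horseshoeSet_transitive

/-! ### The determinant at periodic points. -/

theorem linearPart_iterate (n : ℕ) (y : EuclideanSpace ℝ (Fin 4)) :
    linearPart^[n] y = !₂[4 ^ n * y 0, 4 ^ n * y 1, (4 ^ n)⁻¹ * y 2, (4 ^ n)⁻¹ * y 3] := by
  induction n with
  | zero => ext i; fin_cases i <;> simp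
  | succ n ih =>
    rw [Function.iterate_succ_apply', ih, linearPart_apply]
    ext i; fin_cases i <;> simp <;> ring

theorem det_toEuclideanLin_diagonal (d : Fin 4 → ℝ) :
    LinearMap.det (Matrix.toEuclideanLin (Matrix.diagonal d)) = ∏ i, d i := by
  rw [← Matrix.det_diagonal]
  exact LinearMap.det_toLpLin 2 _

theorem detIdSubDeriv_horseshoe {n : ℕ} {x : S4} (hx : x ∈ horseshoeSet)
    (hn : horseshoe^[n] x = x) :
    |detIdSubDeriv (d := 4) horseshoe n x| = (4 ^ n - 1) ^ 2 * (1 - (4 ^ n)⁻¹) ^ 2 := by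
  have hxU := horseshoeSet_subset_upperCap hx
  set D : EuclideanSpace ℝ (Fin 4) →L[ℝ] EuclideanSpace ℝ (Fin 4) :=
    mfderiv (𝓡 4) (𝓡 4) (horseshoe^[n]) x with hD
  set M : EuclideanSpace ℝ (Fin 4) →ₗ[ℝ] EuclideanSpace ℝ (Fin 4) :=
    Matrix.toEuclideanLin (Matrix.diagonal ![1 - 4 ^ n, 1 - 4 ^ n, 1 - (4 ^ n)⁻¹, 1 - (4 ^ n)⁻¹])
    with hM
  have h1 (v : EuclideanSpace ℝ (Fin 4)) : chartDeriv x (D v) = linearPart^[n] (chartDeriv x v) := by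
    have := chartDeriv_mfderiv_iterate n hx v
    rwa [hn] at this
  -- At a fixed point of the iterate the chart derivatives at source and target coincide, so D is
  -- conjugate to a diagonal matrix and the determinant can be read off.
  have h2 : LinearMap.id - D.toLinearMap =
      (chartDerivEquiv hxU).symm.toLinearMap ∘ₗ M ∘ₗ (chartDerivEquiv hxU).toLinearMap := by
    ext1 v
    apply (chartDerivEquiv hxU).injective
    simp only [LinearMap.comp_apply, LinearEquiv.coe_coe, LinearEquiv.apply_symm_apply]
    change chartDeriv x (v - D v) = M (chartDeriv x v)
    rw [map_sub, h1, linearPart_iterate, hM]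
    ext i
    fin_cases i <;> simp [Matrix.toLpLin_apply, Matrix.mulVec_diagonal] <;> ring
  have h3 : detIdSubDeriv (d := 4) horseshoe n x = (1 - 4 ^ n) ^ 2 * (1 - (4 ^ n)⁻¹) ^ 2 := by
    change LinearMap.det (LinearMap.id - D.toLinearMap) = _
    have h4 := LinearMap.det_conj M (chartDerivEquiv hxU).symm
    rw [LinearEquiv.symm_symm] at h4
    rw [h2, h4, hM, det_toEuclideanLin_diagonal]
    simp [Fin.prod_univ_four]; ring
  rw [h3, abs_of_nonneg (by positivity)]
  ring

/-! ### Weights along orbits. -/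

/-- The weight of a one-sided sequence. -/
noncomputable def sequenceWeight (α : ℕ → ℂ) (b : ℕ → Bool) : ℂ := 1 + bumpSeries α (digitSum b)

theorem digitSum_of_false {b : ℕ → Bool} {k : ℕ} (h : ∀ i < k, b i = false) :
    4 ^ k * digitSum b = digitSum fun j ↦ b (j + k) := by
  induction k with
  | zero => simp
  | succ k ih =>
    rw [pow_succ', mul_assoc, ih fun i hi ↦ h i (by omega), digitSum_eq, zero_add, h k (by omega)]
    simp only [Bool.false_eq_true, reduceIte, zero_div, zero_add]
    have : (fun j ↦ b (j + 1 + k)) = fun j ↦ b (j + (k + 1)) := by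
      ext j; congr 1; ring
    rw [this]; ring

theorem sequenceWeight_of_false (α : ℕ → ℂ) {b : ℕ → Bool} (h : b 0 = false) :
    sequenceWeight α b = 1 := by
  have h1 := digitSum_eq b
  have h2 := digitSum_le_one fun j ↦ b (j + 1)
  rw [h] at h1
  simp only [Bool.false_eq_true, reduceIte] at h1
  rw [sequenceWeight, bumpSeries_of_le α (by linarith), add_zero]

/-- Subtracting 3/4 removes the leading digit and the factor 4^(k+1) the k zeros after it; what
remains starts with the digit 3, so it lies in [3/4, 1], where the k-th bump equals 1. -/
theorem sequenceWeight_of_true (α : ℕ → ℂ) {b : ℕ → Bool} (h : b 0 = true) {k : ℕ}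
    (h1 : ∀ i < k, b (i + 1) = false) (h2 : b (k + 1) = true) :
    sequenceWeight α b = 1 + α k := by
  have e1 := digitSum_eq b
  have e2 := digitSum_of_false (b := fun j ↦ b (j + 1)) h1
  have e3 := digitSum_eq fun j ↦ b (j + k + 1)
  have e4 := digitSum_le_one fun j ↦ b (j + k + 1)
  have e5 := digitSum_nonneg fun j ↦ b (j + 1 + k + 1)
  rw [zero_add, h2] at e3
  rw [h] at e1
  simp only [reduceIte] at e1 e3
  have e : 4 ^ (k + 1) * (digitSum b - 3 / 4) = digitSum fun j ↦ b (j + k + 1) := by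
    rw [e1, ← e2]; ring
  rw [sequenceWeight, bumpSeries_of_mem α k (by rw [e]; linarith) (by rw [e]; exact e4)]

theorem sequenceWeight_of_tail_false (α : ℕ → ℂ) {b : ℕ → Bool} (h : ∀ i, b (i + 1) = false) :
    sequenceWeight α b = 1 := by
  have h1 := digitSum_eq b
  have h2 : digitSum (fun j ↦ b (j + 1)) = 0 := by simp [digitSum, h]
  rw [h2] at h1
  rw [sequenceWeight, bumpSeries_of_le α, add_zero]
  rw [h1]
  split_ifs <;> norm_num

theorem leadingFalse_spec (n : ℕ) (b : ℕ → Bool) (k : ℕ) (h1 : ∀ i < k, b (n + i) = false)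
    (h2 : b (n + k) = true) :
    (∀ i < leadingFalse n (fun i ↦ b i) k, b i = false) ∧
      b (leadingFalse n (fun i ↦ b i) k) = true := by
  induction n generalizing b with
  | zero =>
    simp only [zero_add] at h1 h2
    exact ⟨h1, h2⟩
  | succ n ih =>
    have e : (Fin.tail fun i : Fin (n + 1) ↦ b i) = fun i : Fin n ↦ b (i + 1) := by
      ext i; simp [Fin.tail]
    obtain ⟨h3, h4⟩ := ih (fun j ↦ b (j + 1))
      (fun i hi ↦ by rw [← h1 i hi]; congr 1; ring) (by rw [← h2]; congr 1; ring)
    rw [leadingFalse, e]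
    by_cases h0 : b ((0 : Fin (n + 1)) : ℕ) = true
    · rw [if_pos h0]
      exact ⟨fun i hi ↦ absurd hi (Nat.not_lt_zero i), h0⟩
    · rw [if_neg h0]
      refine ⟨fun i hi ↦ ?_, h4⟩
      rcases i with - | i
      · simpa using h0
      · exact h3 i (by omega)

/-- Beyond the word, only the distance k to the next `true` influences the weights. -/
theorem prod_sequenceWeight (α : ℕ → ℂ) (n : ℕ) (b : ℕ → Bool) (k : ℕ)
    (h1 : ∀ i < k, b (n + i) = false) (h2 : b (n + k) = true) :
    ∏ i ∈ Finset.range n, sequenceWeight α (fun j ↦ b (j + i)) =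
      wordWeight (fun k ↦ 1 + α k) n (fun i ↦ b i) k := by
  induction n generalizing b with
  | zero => simp [wordWeight]
  | succ n ih =>
    have e : (Fin.tail fun i : Fin (n + 1) ↦ b i) = fun i : Fin n ↦ b (i + 1) := by
      ext i; simp [Fin.tail]
    have h1' : ∀ i < k, b (n + i + 1) = false := fun i hi ↦ by rw [← h1 i hi]; congr 1; ring
    have h2' : b (n + k + 1) = true := by rw [← h2]; congr 1; ring
    have h3 := ih (fun j ↦ b (j + 1)) h1' h2'
    have h4 := leadingFalse_spec n (fun j ↦ b (j + 1)) k h1' h2'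
    rw [Finset.prod_range_succ', wordWeight, e, ← h3, mul_comm]
    congr 1
    · simp only [add_zero]
      by_cases h0 : b ((0 : Fin (n + 1)) : ℕ) = true
      · rw [if_pos h0]
        exact sequenceWeight_of_true α h0 h4.1 h4.2
      · rw [if_neg h0]
        exact sequenceWeight_of_false α (by simpa using h0)

theorem prod_sequenceWeight_of_periodic (α : ℕ → ℂ) {n : ℕ} (b : ℕ → Bool)
    (hb : ∀ j, b (j + n) = b j) (hn : n ≠ 0) :
    ∏ i ∈ Finset.range n, sequenceWeight α (fun j ↦ b (j + i)) =
      cyclicWeight (fun k ↦ 1 + α k) n (fun i ↦ b i) := by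
  classical
  rw [cyclicWeight]
  have hper : ∀ j, b (j % n) = b j := (show Function.Periodic b n from hb).map_mod_nat
  split_ifs with h
  · have hb0 (j : ℕ) : b j = false := by
      rw [← hper]; exact h ⟨j % n, Nat.mod_lt _ (Nat.pos_of_ne_zero hn)⟩
    exact Finset.prod_eq_one fun i _ ↦ sequenceWeight_of_false α (hb0 _)
  · have hex : ∃ k, b k = true := by
      push Not at h
      obtain ⟨i, hi⟩ := h
      exact ⟨i, by simpa using hi⟩
    have h1 : ∀ i < Nat.find hex, b (n + i) = false := fun i hi ↦ by
      rw [add_comm, hb]; simpa using Nat.find_min hex hi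
    have h2 : b (n + Nat.find hex) = true := by
      rw [add_comm, hb]; exact Nat.find_spec hex
    rw [prod_sequenceWeight α n b _ h1 h2]
    congr 1
    -- By periodicity the word is followed by its own beginning, so the padding is the position of
    -- the first `true` of the sequence.
    rw [← (leadingFalse_lt n (fun i ↦ b i) h (Nat.find hex)).2]
    obtain ⟨h3, h4⟩ := leadingFalse_spec n b _ h1 h2
    apply le_antisymm
    · exact Nat.find_min' hex h4
    · by_contra hc
      simpa [Nat.find_spec hex] using h3 _ (not_le.1 hc)

/-- The weight function on the sphere. -/
noncomputable def sphereWeight (α : ℕ → ℂ) (x : S4) : ℂ := 1 + bumpSeries α (gnomonicInv x 0)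

theorem sphereWeight_codeSphere (α : ℕ → ℂ) (s : ℤ → Bool) :
    sphereWeight α (codeSphere s) = sequenceWeight α fun j ↦ s j := by
  rw [sphereWeight, gnomonicInv_codeSphere, sequenceWeight]; rfl

theorem birkhoffProduct_codeSphere (α : ℕ → ℂ) (n : ℕ) (s : ℤ → Bool) :
    birkhoffProduct horseshoe (sphereWeight α) n (codeSphere s) =
      ∏ i ∈ Finset.range n, sequenceWeight α fun j ↦ s ((j + i : ℕ) : ℤ) := by
  refine Finset.prod_congr rfl fun i _ ↦ ?_
  rw [horseshoe_iterate_codeSphere, sphereWeight_codeSphere]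
  simp [shiftBy]

/-! ### Periodic points and traces of the horseshoe. -/

/-- The periodic bi-infinite repetition of a word. -/
def periodicExtension {n : ℕ} (hn : n ≠ 0) (a : Fin n → Bool) : ℤ → Bool :=
  fun i ↦ a ⟨(i % n).toNat, by
    have := Int.emod_lt_of_pos i (show (0 : ℤ) < n by omega)
    have := Int.emod_nonneg i (show (n : ℤ) ≠ 0 by omega)
    omega⟩

theorem shiftBy_periodicExtension {n : ℕ} (hn : n ≠ 0) (a : Fin n → Bool) :
    shiftBy n (periodicExtension hn a) = periodicExtension hn a := by
  ext i
  simp only [shiftBy, periodicExtension, Int.add_emod_right]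

theorem periodicExtension_apply {n : ℕ} (hn : n ≠ 0) (a : Fin n → Bool) (i : Fin n) :
    periodicExtension hn a (i : ℕ) = a i := by
  rw [periodicExtension]
  congr 1
  ext
  simp only
  rw [Int.emod_eq_of_lt (by omega) (by omega)]
  simp

theorem eq_periodicExtension {n : ℕ} (hn : n ≠ 0) {s : ℤ → Bool} (hs : shiftBy n s = s) :
    s = periodicExtension hn fun i ↦ s (i : ℕ) := by
  have hp : Function.Periodic s (n : ℤ) := fun i ↦ congrFun hs i
  ext i
  have h0 := Int.emod_nonneg i (show (n : ℤ) ≠ 0 by omega)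
  simp only [periodicExtension, Int.toNat_of_nonneg h0]
  have := hp.sub_zsmul_eq (x := i) (i / n)
  rw [← this, smul_eq_mul, Int.emod_def, mul_comm]

theorem periodicPointsIn_horseshoe {n : ℕ} (hn : n ≠ 0) :
    periodicPointsIn horseshoe horseshoeSet n =
      Set.range fun a ↦ codeSphere (periodicExtension hn a) := by
  apply Set.Subset.antisymm
  · rintro _ ⟨⟨s, rfl⟩, h⟩
    rw [horseshoe_iterate_codeSphere] at h
    exact ⟨_, congrArg codeSphere (eq_periodicExtension hn (codeSphere_injective h)).symm⟩
  · rintro _ ⟨a, rfl⟩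
    refine ⟨⟨_, rfl⟩, ?_⟩
    rw [horseshoe_iterate_codeSphere, shiftBy_periodicExtension]

theorem periodicExtension_injective {n : ℕ} (hn : n ≠ 0) :
    Function.Injective (periodicExtension hn) := by
  intro a a' h
  ext i
  rw [← periodicExtension_apply hn a, h, periodicExtension_apply]

theorem finsum_periodicPointsIn_horseshoe {n : ℕ} (hn : n ≠ 0) (F : S4 → ℂ) :
    ∑ᶠ x ∈ periodicPointsIn horseshoe horseshoeSet n, F x =
      ∑ a, F (codeSphere (periodicExtension hn a)) := by
  rw [periodicPointsIn_horseshoe hn, finsum_mem_range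
    (show Function.Injective fun a ↦ codeSphere (periodicExtension hn a) from
      codeSphere_injective.comp (periodicExtension_injective hn)), finsum_eq_sum_of_fintype]

/-- The traces of the horseshoe. -/
noncomputable def horseshoeTrace (α : ℕ → ℂ) (n : ℕ) : ℂ :=
  ∑ a : Fin n → Bool, cyclicWeight (fun k ↦ 1 + α k) n a

theorem sum_birkhoffProduct_horseshoe (α : ℕ → ℂ) {n : ℕ} (hn : n ≠ 0) :
    ∑ᶠ x ∈ periodicPointsIn horseshoe horseshoeSet n,
      birkhoffProduct horseshoe (sphereWeight α) n x = horseshoeTrace α n := by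
  rw [finsum_periodicPointsIn_horseshoe hn]
  refine Finset.sum_congr rfl fun a _ ↦ ?_
  rw [birkhoffProduct_codeSphere, prod_sequenceWeight_of_periodic α
    (fun j ↦ periodicExtension hn a (j : ℤ)) (fun j ↦ ?_) hn]
  · simp only [periodicExtension_apply]
  · push_cast
    exact congrFun (shiftBy_periodicExtension hn a) j

theorem flatTrace_horseshoe (α : ℕ → ℂ) {n : ℕ} (hn : n ≠ 0) :
    flatTrace (d := 4) horseshoe horseshoeSet (sphereWeight α) n =
      horseshoeTrace α n / (((4 ^ n - 1) ^ 2 * (1 - (4 ^ n)⁻¹) ^ 2 : ℝ) : ℂ) := by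
  rw [flatTrace, ← sum_birkhoffProduct_horseshoe α hn, finsum_periodicPointsIn_horseshoe hn,
    finsum_periodicPointsIn_horseshoe hn, Finset.sum_div]
  refine Finset.sum_congr rfl fun a _ ↦ ?_
  rw [detIdSubDeriv_horseshoe ⟨_, rfl⟩]
  rw [horseshoe_iterate_codeSphere, shiftBy_periodicExtension]

theorem expTrace_congr {t t' : ℕ → ℂ} (h : ∀ n ≠ 0, t n = t' n) : expTrace t = expTrace t' := by
  rw [expTrace, expTrace]
  congr 2
  ext n
  split_ifs with hn
  · rfl
  · rw [h n hn]

theorem inv_dynamicalZeta_horseshoe (α : ℕ → ℂ) :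
    (dynamicalZeta horseshoe horseshoeSet (sphereWeight α))⁻¹ = zetaInverse α := by
  rw [← expTrace_sum_cyclicWeight]
  exact congrArg _ (expTrace_congr fun n hn ↦ sum_birkhoffProduct_horseshoe α hn)

theorem dynamicalDeterminant_horseshoe (α : ℕ → ℂ) :
    dynamicalDeterminant (d := 4) horseshoe horseshoeSet (sphereWeight α) =
      expTrace fun n ↦ -flatTrace (d := 4) horseshoe horseshoeSet (sphereWeight α) n := by
  rw [dynamicalDeterminant, expTrace]
  simp only [mul_neg]

/-! ### Regularity and positivity of the weight, and the conclusion. -/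

theorem four_pow_lt_of_lt_log {ρ : ℝ≥0∞} {r : ℕ}
    (h : ((r : ℝ) : EReal) < ENNReal.log ρ / ((Real.log 4 : ℝ) : EReal)) :
    ENNReal.ofReal (4 ^ r) < ρ := by
  have h4 : 0 < Real.log 4 := Real.log_pos (by norm_num)
  rw [EReal.lt_div_iff (by exact_mod_cast h4) (EReal.coe_ne_top _)] at h
  rw [← ENNReal.log_lt_log_iff, ENNReal.log_ofReal_of_pos (by positivity), Real.log_pow,
    EReal.coe_mul]
  exact h

theorem contMDiff_sphereWeight {α : ℕ → ℂ} {r : ℕ}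
    (h : ENNReal.ofReal (4 ^ r) < (FormalMultilinearSeries.ofScalars ℂ α).radius) :
    ContMDiff (𝓡 4) 𝓘(ℝ, ℂ) r (sphereWeight α) := by
  have hs : Summable fun k ↦ ‖α k‖ * ((4 : ℝ) ^ r) ^ k := by
    have := (summable_mul_pow_of_lt_radius (z := (4 ^ r : ℝ)) (α := α) (by
      rw [← ofReal_norm, Complex.norm_real, Real.norm_of_nonneg (by positivity)]
      exact h)).norm
    refine this.congr fun k ↦ ?_
    rw [norm_mul, norm_pow, Complex.norm_real, Real.norm_of_nonneg (by positivity)]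
  have h0 : ContDiff ℝ r fun y : EuclideanSpace ℝ (Fin 4) ↦ 1 + bumpSeries α (y 0) :=
    contDiff_const.add ((contDiff_bumpSeries hs).comp (by fun_prop))
  exact h0.contMDiff.comp (contMDiff_gnomonicInv.of_le (by exact_mod_cast le_top))

theorem sphereWeight_pos {α : ℕ → ℂ} (h : ∀ k, ∃ a : ℝ, -1 < a ∧ α k = (a : ℂ)) {x : S4}
    (hx : x ∈ horseshoeSet) : ∃ b : ℝ, 0 < b ∧ sphereWeight α x = (b : ℂ) := by
  classical
  obtain ⟨s, rfl⟩ := hx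
  rw [sphereWeight_codeSphere]
  set b : ℕ → Bool := fun j ↦ s j
  by_cases h0 : b 0
  · by_cases hex : ∃ k, b (k + 1) = true
    · obtain ⟨a, ha, hk⟩ := h (Nat.find hex)
      refine ⟨1 + a, by linarith, ?_⟩
      rw [sequenceWeight_of_true α h0 (fun i hi ↦ by simpa using Nat.find_min hex hi)
        (Nat.find_spec hex), hk]
      push_cast; rfl
    -- A final `true` followed only by `false` has u = 3/4 exactly, where all bumps vanish.
    · push Not at hex
      exact ⟨1, one_pos, by
        rw [sequenceWeight_of_tail_false α fun i ↦ by simpa using hex i]; simp⟩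
  · exact ⟨1, one_pos, by rw [sequenceWeight_of_false α (by simpa using h0)]; simp⟩

theorem proposition3p2 :
    ∃ (T : S4 ≃ₘ⟮𝓡 4, 𝓡 4⟯ S4) (K : Set S4),
      IsHyperbolicBasicSet T K ∧
      (∀ n : ℕ, 1 ≤ n → (periodicPointsIn T K n).Finite) ∧
      ∀ (h : ℂ → ℂ) (α : ℕ → ℂ) (ρ : ℝ≥0∞),
        HasFPowerSeriesAt h (FormalMultilinearSeries.ofScalars ℂ α) 0 →
        ρ = (FormalMultilinearSeries.ofScalars ℂ α).radius →
        (∀ k, α k ≠ -1) →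
        1 < ρ →
        ∃ g : S4 → ℂ,
          -- the formula for the zeta function: as formal power series, and as functions near `0`
          (dynamicalZeta T K g)⁻¹ =
            1 - 2 * PowerSeries.X
              - PowerSeries.X * (1 - PowerSeries.X) * PowerSeries.mk α ∧
          (∀ᶠ z in 𝓝 (0 : ℂ), HasSum (seriesTerm (dynamicalZeta T K g)⁻¹ z)
            (1 - 2 * z - z * (1 - z) * h z)) ∧
          -- the formula for the dynamical determinant, on the disc of radius `16 ρ`
          (∀ z : ℂ, ‖z‖ₑ < ρ → Summable (seriesTerm (dynamicalZeta T K g)⁻¹ z)) ∧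
          (∀ z : ℂ, ‖z‖ₑ < 16 * ρ →
            Summable (seriesTerm (dynamicalDeterminant (d := 4) T K g) z)) ∧
          HasProdLocallyUniformlyOn
            (fun (k : ℕ) (z : ℂ) ↦ seriesSum (dynamicalZeta T K g)⁻¹ (z / 4 ^ (k + 2)) ^
              ((k + 1) * (k + 2) * (k + 3) / 6))
            (seriesSum (dynamicalDeterminant (d := 4) T K g))
            {z : ℂ | ‖z‖ₑ < 16 * ρ} ∧
          -- regularity
          (∀ r : ℕ, ((r : ℝ) : EReal) < ENNReal.log ρ / ((Real.log 4 : ℝ) : EReal) →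
            ContMDiff (𝓡 4) 𝓘(ℝ, ℂ) r g) ∧
          -- positivity
          ((∀ k, ∃ a : ℝ, -1 < a ∧ α k = (a : ℂ)) →
            ∀ x ∈ K, ∃ b : ℝ, 0 < b ∧ g x = (b : ℂ)) := by
  refine ⟨horseshoe, horseshoeSet, isHyperbolicBasicSet_horseshoeSet, fun n hn ↦ ?_,
    fun h α ρ hh hρ _ hρ1 ↦ ⟨sphereWeight α, ?_, ?_, ?_, ?_⟩⟩
  · rw [periodicPointsIn_horseshoe (Nat.one_le_iff_ne_zero.1 hn)]
    exact Set.finite_range _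
  · exact inv_dynamicalZeta_horseshoe α
  · filter_upwards [hh.eventually_hasSum] with z hz
    rw [inv_dynamicalZeta_horseshoe]
    apply hasSum_seriesTerm_zetaInverse
    rw [zero_add] at hz
    refine HasSum.congr_fun hz fun n ↦ ?_
    rw [FormalMultilinearSeries.ofScalars_apply_eq, smul_eq_mul]
  · intro z hz
    rw [inv_dynamicalZeta_horseshoe]
    exact (hasSum_seriesTerm_zetaInverse (summable_mul_pow_of_lt_radius (hρ ▸ hz)).hasSum).summable
  -- Writing ζ⁻¹ as the exponential of the negated traces gives it the same form as the determinant,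
  -- so the infinite product applies with traces of the same sign.
  · have hzeta : zetaInverse α = expTrace fun n ↦ -horseshoeTrace α n := by
      rw [← expTrace_sum_cyclicWeight, ← expTrace_neg]; rfl
    have key := hasProdLocallyUniformlyOn_expTrace (t := fun n ↦ -horseshoeTrace α n)
      (f := fun n ↦ -flatTrace (d := 4) horseshoe horseshoeSet (sphereWeight α) n)
      (R := ρ) (zero_lt_one.trans hρ1) (fun z hz ↦ by
        rw [← hzeta]
        exact (hasSum_seriesTerm_zetaInverse
          (summable_mul_pow_of_lt_radius (hρ ▸ hz)).hasSum).summable) fun n hn ↦ by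
        rw [flatTrace_horseshoe α hn, ← neg_div]
        exact hasSum_inv_det n hn _
    rw [dynamicalDeterminant_horseshoe, inv_dynamicalZeta_horseshoe, hzeta]
    exact ⟨key.1, key.2, fun r hr ↦ contMDiff_sphereWeight (hρ ▸ four_pow_lt_of_lt_log hr),
      fun hα x hx ↦ sphereWeight_pos hα hx⟩
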